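/- **Setting.** Fix $T>0$. Let $\mathcal M([0,1])$ be the space of probability distributions on $[0,1]$ with the weak topology, and for a metric space $E$ let $D(E,[0,T])$ be the space of càdlàg paths $[0,T]\to E$ with the Skorokhod ($J_1$) topology. Let $\mathscr W$ be the set of symmetric measurable functions $[0,1]^2\to[0,1]$ modulo a.e. equality, and let $(\tilde{\mathscr W},\delta_\square)$ be the space of unlabelled graphons, i.e. $\mathscr W$ with graphons at cut distance $0$ identified, where $$\delta_\square(\tilde f,\tilde g)=\inf_{\sigma_1,\sigma_2}\ \sup_{A,B\subseteq[0,1]}\Big|\int_{A\times B}\big(f^{\sigma_1}-g^{\sigma_2}\big)\,dx\,dy\Big| ,$$ $\sigma_1,\sigma_2$ run over the measure-preserving bijections of $[0,1]$, and $f^\sigma(x,y)=f(\sigma(x),\sigma(y))$. Write $\tilde f$ for the class of $f$ in $\tilde{\mathscr W}$. For a graph $G$ on $\{1,\dots,n\}$, let $h^G(x,y)=1$ if the vertices $\lceil nx\rceil$ and $\lceil ny\rceil$ are joined by an edge, and $h^G(x,y)=0$ otherwise. Let $H\colon[0,T]\times[0,1]^2\times D(\mathcal M([0,1]),[0,T])\to[0,1]$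 be symmetric and measurable in its two $[0,1]$-arguments. For $F\in D(\mathcal M([0,1]),[0,T])$ put $$g^{[F]}(t;x,y)=H\big(t;\bar F(t;x),\bar F(t;y),F\big),\qquad \bar F(t;u)=\inf\{x\in[0,1]:F(t;x)>u\}.$$ For every $n\ge1$ let $X_1(t),\dots,X_n(t)\in[0,1]$, $t\in[0,T]$, be random types whose empirical distribution process $F_n(t;x)=\frac1n\sum_{i=1}^n\mathbf 1\{X_i(t)\le x\}$ has càdlàg paths, and let $(G_n(t))_{t\in[0,T]}$ be a process of random graphs on $\{1,\dots,n\}$ such that, for each fixed $t$, conditionally on $X_1(t),\dots,X_n(t)$ and on the whole path $F_n$, distinct edges are independent and edge $ij$ is present with probability $H(t;X_i(t),X_j(t),F_n)$. Nothing is assumed about the joint law of the graphs at different times. A rate function is a function with values in $[0,\infty]$ that is not identically $\infty$, is lower semicontinuous and has compact level sets. Random elements $Z_n$ satisfy the LDP with rate $\ell(n)\to\infty$ and rate function $I$ if $I$ is a rate function, $\limsup_n\frac1{\ell(n)}\log\mathbb P(Z_n\in C)\le-\inf_CI$ for all closed $C$, and $\liminf_n\frac1{\ell(n)}\log\mathbb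 P(Z_n\in O)\ge-\inf_OI$ for all open $O$ (for non-measurable events, with outer probability in the upper bound and inner probability in the lower bound). **Assumptions.** - (CP) $F\mapsto g^{[F]}$ is a continuous map from $D(\mathcal M([0,1]),[0,T])$ to $D((\mathscr W,\|\cdot\|_{L^1}),[0,T])$. - (DP) $(F_n)$ satisfies the LDP on $D(\mathcal M([0,1]),[0,T])$ with rate $\ell(n)=o\big(\binom n2\big)$ and rate function $K$. **Proposition.** Assume (CP) and (DP). Let $S\subseteq[0,T]$ be any set of times at which the graphon paths of finite rate do not jump: for every $F$ with $K(F)<\infty$, the path $s\mapsto\tilde g^{[F]}(s)\in(\tilde{\mathscr W},\delta_\square)$ is continuous at every $t\in S$ with $t<T$. Then $\big((\tilde h^{G_n(t)})_{t\in S}\big)_{n}$ satisfies the LDP on $\tilde{\mathscr W}^{S}$ with the topology of pointwise convergence (product topology), with rate $\ell(n)$ and rate function $$J_S(\tilde h)=\inf\{K(F):\ F\in D(\mathcal M([0,1]),[0,T]),\ \tilde g^{[F]}(t)=\tilde h(t)\ \text{for all }t\in S\}.$$ In particular, if no path $\tilde g^{[F]}$ with $K(F)<\infty$ jumps before time $T$,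 then $\big((\tilde h^{G_n(t)})_{t\in[0,T]}\big)_n$ satisfies the LDP in the pointwise topology with rate $\ell(n)$ and rate function $J(\tilde h)=\inf\{K(F):\tilde g^{[F]}=\tilde h\}$. The rate function depends only on $K$ and $H$, not on the edge-switching dynamics. -/

import Mathlib

open MeasureTheory Filter Topology Set
open scoped ENNReal

noncomputable section

/-! ## Graphons, the `L¹` distance and the cut metric -/

/-- A symmetric measurable function `[0,1]² → [0,1]` (a representative of a graphon). -/
structure Kern where
  toFun : unitInterval → unitInterval → unitInterval
  symm : ∀ x y, toFun x y = toFun y x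
  meas : Measurable fun p : unitInterval × unitInterval => toFun p.1 p.2

namespace Kern

/-- The pointwise difference of two kernels. -/
def diff (f g : Kern) (p : unitInterval × unitInterval) : ℝ := (f.toFun p.1 p.2 : ℝ) - (g.toFun p.1 p.2 : ℝ)

lemma measurable_diff (f g : Kern) : Measurable (f.diff g) :=
  (measurable_subtype_coe.comp f.meas).sub (measurable_subtype_coe.comp g.meas)

lemma abs_diff_le (f g : Kern) (p : unitInterval × unitInterval) : |f.diff g p| ≤ 1 := by
  have h1 := (f.toFun p.1 p.2).2
  have h2 := (g.toFun p.1 p.2).2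
  simp only [diff]
  rw [abs_le]
  constructor <;> linarith [h1.1, h1.2, h2.1, h2.2]

lemma integrable_diff (f g : Kern) : Integrable (f.diff g) (volume : Measure (unitInterval × unitInterval)) :=
  Integrable.of_bound (f.measurable_diff g).aestronglyMeasurable 1
    (Eventually.of_forall fun p => by simpa using f.abs_diff_le g p)

lemma diff_add (f g h : Kern) (p : unitInterval × unitInterval) : f.diff h p = f.diff g p + g.diff h p := by
  simp [diff]

/-- `‖f - g‖_{L¹([0,1]²)}`. -/
def l1Dist (f g : Kern) : ℝ := ∫ p : unitInterval × unitInterval, |f.diff g p|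

lemma l1Dist_self (f : Kern) : l1Dist f f = 0 := by simp [l1Dist, diff]

lemma l1Dist_comm (f g : Kern) : l1Dist f g = l1Dist g f := by
  simp only [l1Dist, diff]
  congr 1
  ext p
  rw [abs_sub_comm]

lemma l1Dist_triangle (f g h : Kern) : l1Dist f h ≤ l1Dist f g + l1Dist g h := by
  simp only [l1Dist]
  rw [← integral_add (f.integrable_diff g).abs (g.integrable_diff h).abs]
  refine integral_mono (f.integrable_diff h).abs
    ((f.integrable_diff g).abs.add (g.integrable_diff h).abs) fun p => ?_
  simp only [diff_add f g h p]
  exact abs_add_le _ _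

/-- Measurable subsets of `[0,1]`. -/
abbrev MSet := {A : Set unitInterval // MeasurableSet A}

instance : Nonempty MSet := ⟨⟨∅, MeasurableSet.empty⟩⟩

/-- `d_□(f, g) = sup_{A, B} |∫_{A × B} (f - g)|`, over measurable `A, B ⊆ [0,1]`. -/
def cutDist (f g : Kern) : ℝ :=
  ⨆ AB : MSet × MSet, |∫ p in AB.1.1 ×ˢ AB.2.1, f.diff g p|

lemma bddAbove_cut (f g : Kern) :
    BddAbove (range fun AB : MSet × MSet => |∫ p in AB.1.1 ×ˢ AB.2.1, f.diff g p|) := by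
  refine ⟨1, ?_⟩
  rintro _ ⟨AB, rfl⟩
  have h := norm_setIntegral_le_of_norm_le_const (μ := (volume : Measure (unitInterval × unitInterval)))
    (s := AB.1.1 ×ˢ AB.2.1) (f := f.diff g) (C := 1) (measure_lt_top _ _)
    (fun p _ => by simpa using f.abs_diff_le g p)
  rw [Real.norm_eq_abs, one_mul] at h
  exact h.trans measureReal_le_one

lemma cutDist_nonneg (f g : Kern) : 0 ≤ cutDist f g :=
  Real.iSup_nonneg fun _ => abs_nonneg _

lemma cutDist_self (f : Kern) : cutDist f f = 0 := by simp [cutDist, diff]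

lemma cutDist_comm (f g : Kern) : cutDist f g = cutDist g f := by
  have h : ∀ p, f.diff g p = - g.diff f p := fun p => by simp [diff]
  simp only [cutDist, h, integral_neg, abs_neg]

lemma cutDist_triangle (f g h : Kern) : cutDist f h ≤ cutDist f g + cutDist g h := by
  refine ciSup_le fun AB => ?_
  have e : ∫ p in AB.1.1 ×ˢ AB.2.1, f.diff h p =
      (∫ p in AB.1.1 ×ˢ AB.2.1, f.diff g p) + ∫ p in AB.1.1 ×ˢ AB.2.1, g.diff h p := by
    rw [← integral_add (f.integrable_diff g).integrableOn (g.integrable_diff h).integrableOn]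
    simp only [diff_add f g h]
  rw [e]
  exact (abs_add_le _ _).trans
    (add_le_add (le_ciSup (bddAbove_cut f g) AB) (le_ciSup (bddAbove_cut g h) AB))

/-- The measure-preserving bijections of `[0,1]`. -/
abbrev MPBij := {σ : unitInterval ≃ᵐ unitInterval // MeasurePreserving σ volume volume}

instance : Nonempty MPBij := ⟨⟨MeasurableEquiv.refl unitInterval, MeasurePreserving.id _⟩⟩

/-- `f^σ(x, y) = f(σ x, σ y)`. -/
def relabel (f : Kern) (σ : MPBij) : Kern where
  toFun x y := f.toFun (σ.1 x) (σ.1 y)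
  symm _ _ := f.symm _ _
  meas := f.meas.comp
    ((σ.1.measurable.comp measurable_fst).prodMk (σ.1.measurable.comp measurable_snd))

/-- Inverse of a measure-preserving bijection. -/
def MPBij.inv (σ : MPBij) : MPBij := ⟨σ.1.symm, σ.2.symm σ.1⟩

/-- Composition: first `σ`, then `τ`. -/
def MPBij.trans (σ τ : MPBij) : MPBij := ⟨σ.1.trans τ.1, τ.2.comp σ.2⟩

lemma relabel_trans (f : Kern) (σ τ : MPBij) :
    f.relabel (σ.trans τ) = (f.relabel τ).relabel σ := rfl

lemma relabel_relabel_inv (f : Kern) (σ : MPBij) : (f.relabel σ).relabel σ.inv = f := by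
  cases f
  simp [relabel, MPBij.inv]

lemma relabel_inv_relabel (f : Kern) (σ : MPBij) : (f.relabel σ.inv).relabel σ = f := by
  cases f
  simp [relabel, MPBij.inv]

lemma cutDist_relabel_le (f g : Kern) (σ : MPBij) :
    cutDist (f.relabel σ) (g.relabel σ) ≤ cutDist f g := by
  refine ciSup_le fun AB => ?_
  have hmp : MeasurePreserving (σ.1.prodCongr σ.1) (volume : Measure (unitInterval × unitInterval)) volume :=
    σ.2.prod σ.2
  have hs : AB.1.1 ×ˢ AB.2.1 =
      (σ.1.prodCongr σ.1) ⁻¹' ((σ.1.symm ⁻¹' AB.1.1) ×ˢ (σ.1.symm ⁻¹' AB.2.1)) := by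
    ext p
    simp [MeasurableEquiv.prodCongr]
  have e : ∫ p in AB.1.1 ×ˢ AB.2.1, (f.relabel σ).diff (g.relabel σ) p =
      ∫ p in (σ.1.symm ⁻¹' AB.1.1) ×ˢ (σ.1.symm ⁻¹' AB.2.1), f.diff g p := by
    have h := hmp.setIntegral_preimage_emb (σ.1.prodCongr σ.1).measurableEmbedding (f.diff g)
      ((σ.1.symm ⁻¹' AB.1.1) ×ˢ (σ.1.symm ⁻¹' AB.2.1))
    rw [← hs] at h
    exact h
  rw [e]
  exact le_ciSup (bddAbove_cut f g)
    (⟨⟨_, σ.1.symm.measurable AB.1.2⟩, ⟨_, σ.1.symm.measurable AB.2.2⟩⟩ : MSet × MSet)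

/-- The cut metric `δ_□(f, g) = inf_{σ₁, σ₂} d_□(f^{σ₁}, g^{σ₂})`. -/
def cutMetric (f g : Kern) : ℝ :=
  ⨅ σ : MPBij × MPBij, cutDist (f.relabel σ.1) (g.relabel σ.2)

lemma bddBelow_cut (f g : Kern) :
    BddBelow (range fun σ : MPBij × MPBij => cutDist (f.relabel σ.1) (g.relabel σ.2)) :=
  ⟨0, by rintro _ ⟨σ, rfl⟩; exact cutDist_nonneg _ _⟩

lemma cutMetric_nonneg (f g : Kern) : 0 ≤ cutMetric f g :=
  Real.iInf_nonneg fun _ => cutDist_nonneg _ _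

lemma cutMetric_self (f : Kern) : cutMetric f f = 0 := by
  refine le_antisymm ?_ (cutMetric_nonneg f f)
  obtain ⟨σ⟩ := (inferInstance : Nonempty MPBij)
  exact (ciInf_le (bddBelow_cut f f) (σ, σ)).trans (cutDist_self _).le

lemma cutMetric_comm_le (f g : Kern) : cutMetric f g ≤ cutMetric g f := by
  refine le_ciInf fun σ => ?_
  rw [cutDist_comm]
  exact ciInf_le (bddBelow_cut f g) (σ.2, σ.1)

lemma cutMetric_triangle (f g h : Kern) : cutMetric f h ≤ cutMetric f g + cutMetric g h := by
  refine le_ciInf_add_ciInf fun σ τ => ?_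
  have h1 := cutDist_relabel_le (f.relabel σ.1) (g.relabel σ.2) σ.2.inv
  have h2 := cutDist_relabel_le (g.relabel τ.1) (h.relabel τ.2) τ.1.inv
  rw [relabel_relabel_inv] at h1 h2
  rw [← relabel_trans] at h1 h2
  exact (ciInf_le (bddBelow_cut f h) (σ.2.inv.trans σ.1, τ.1.inv.trans τ.2)).trans
    ((cutDist_triangle _ g _).trans (add_le_add h1 h2))

end Kern

/-- Kernels with the `L¹` pseudometric. -/
structure KernL1 where
  ker : Kern

instance : PseudoMetricSpace KernL1 where
  dist f g := Kern.l1Dist f.ker g.ker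
  dist_self f := Kern.l1Dist_self f.ker
  dist_comm f g := Kern.l1Dist_comm f.ker g.ker
  dist_triangle f g h := Kern.l1Dist_triangle f.ker g.ker h.ker

/-- `(𝒲, ‖·‖_{L¹})`: kernels modulo almost everywhere equality, with the `L¹` metric. -/
abbrev GraphonL1 := SeparationQuotient KernL1

/-- The class of a kernel in `(𝒲, ‖·‖_{L¹})`. -/
def Kern.toL1 (f : Kern) : GraphonL1 := SeparationQuotient.mk ⟨f⟩

/-- Kernels with the cut pseudometric `δ_□`. -/
structure KernCut where
  ker : Kern

instance : PseudoMetricSpace KernCut where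
  dist f g := Kern.cutMetric f.ker g.ker
  dist_self f := Kern.cutMetric_self f.ker
  dist_comm f g := le_antisymm (Kern.cutMetric_comm_le _ _) (Kern.cutMetric_comm_le _ _)
  dist_triangle f g h := Kern.cutMetric_triangle f.ker g.ker h.ker

/-- The space `(𝒲̃, δ_□)` of unlabelled graphons: graphons at cut distance `δ_□ = 0` are
identified, so that `δ_□` is a metric. -/
abbrev UGraphon := SeparationQuotient KernCut

/-- The class `f̃` of a kernel `f` in `(𝒲̃, δ_□)`. -/
def Kern.tilde (f : Kern) : UGraphon := SeparationQuotient.mk ⟨f⟩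

open scoped Classical in
/-- The empirical graphon `h^G` of a graph `G`: vertex number `k ∈ {1, …, n}` is the element
`k - 1` of `Fin n`, and `h^G(x, y) = 1` iff the vertices `⌈n x⌉` and `⌈n y⌉` are joined. -/
def empGraphon {n : ℕ} (G : SimpleGraph (Fin n)) : Kern where
  toFun x y := if ∃ i j : Fin n, ⌈(n : ℝ) * x⌉₊ = i + 1 ∧ ⌈(n : ℝ) * y⌉₊ = j + 1 ∧ G.Adj i j
    then 1 else 0
  symm x y := by
    congr 1
    simp only [eq_iff_iff]
    constructor <;> rintro ⟨i, j, hi, hj, h⟩ <;> exact ⟨j, i, hj, hi, h.symm⟩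
  meas := by
    refine Measurable.ite ?_ measurable_const measurable_const
    simp only [ofPred_exists]
    refine MeasurableSet.iUnion fun i => MeasurableSet.iUnion fun j => ?_
    refine MeasurableSet.inter ?_ (MeasurableSet.inter ?_ (MeasurableSet.const _))
    · exact (measurableSet_singleton ((i : ℕ) + 1)).preimage (Nat.measurable_ceil.comp
        (measurable_const.mul (measurable_subtype_coe.comp measurable_fst)))
    · exact (measurableSet_singleton ((j : ℕ) + 1)).preimage (Nat.measurable_ceil.comp
        (measurable_const.mul (measurable_subtype_coe.comp measurable_snd)))

/-! ## Càdlàg paths and the Skorokhod topology -/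

/-- Càdlàg functions `[0,T] → E`. -/
structure CadlagPath (T : ℝ) (E : Type*) [TopologicalSpace E] where
  toFun : Icc (0 : ℝ) T → E
  right_cont : ∀ t, ContinuousWithinAt toFun (Ici t) t
  left_lim : ∀ t, ∃ l, Tendsto toFun (𝓝[<] t) (𝓝 l)

/-- The Skorokhod (`J₁`) distance: the infimum over the increasing bijections `θ` of `[0,T]` of
`max (sup_t |θ t - t|) (sup_t d(f t, g (θ t)))`. -/
def skorokhodEDist {T : ℝ} {E : Type*} [PseudoEMetricSpace E] (f g : CadlagPath T E) : ℝ≥0∞ :=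
  ⨅ θ : Icc (0 : ℝ) T ≃o Icc (0 : ℝ) T,
    max (⨆ t, edist (θ t) t) (⨆ t, edist (f.toFun t) (g.toFun (θ t)))

lemma skorokhodEDist_comm_le {T : ℝ} {E : Type*} [PseudoEMetricSpace E] (f g : CadlagPath T E) :
    skorokhodEDist f g ≤ skorokhodEDist g f := by
  refine le_iInf fun θ => (iInf_le _ θ.symm).trans (max_le_max ?_ ?_)
  · refine iSup_le fun t => ?_
    have h := le_iSup (fun s => edist (θ s) s) (θ.symm t)
    simp only [OrderIso.apply_symm_apply] at h
    rwa [edist_comm] at h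
  · refine iSup_le fun t => ?_
    have h := le_iSup (fun s => edist (g.toFun s) (f.toFun (θ s))) (θ.symm t)
    simp only [OrderIso.apply_symm_apply] at h
    rwa [edist_comm] at h

/-- The space `D(E, [0,T])` with the Skorokhod topology. -/
instance {T : ℝ} {E : Type*} [PseudoEMetricSpace E] : PseudoEMetricSpace (CadlagPath T E) where
  edist := skorokhodEDist
  edist_self f := by
    refine le_antisymm ((iInf_le _ (OrderIso.refl _)).trans ?_) bot_le
    simp
  edist_comm f g := le_antisymm (skorokhodEDist_comm_le f g) (skorokhodEDist_comm_le g f)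
  edist_triangle f g h := by
    refine ENNReal.le_iInf_add_iInf fun θ η => (iInf_le _ (θ.trans η)).trans (max_le ?_ ?_)
    · refine iSup_le fun t => (edist_triangle _ (θ t) _).trans ?_
      rw [add_comm]
      exact add_le_add ((le_iSup (fun s => edist (θ s) s) t).trans (le_max_left _ _))
        ((le_iSup (fun s => edist (η s) s) (θ t)).trans (le_max_left _ _))
    · refine iSup_le fun t => (edist_triangle _ (g.toFun (θ t)) _).trans ?_
      exact add_le_add
        ((le_iSup (fun s => edist (f.toFun s) (g.toFun (θ s))) t).trans (le_max_right _ _))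
        ((le_iSup (fun s => edist (g.toFun s) (h.toFun (η s))) (θ t)).trans (le_max_right _ _))

/-! ## Type distributions and induced reference graphons -/

/-- `𝓜([0,1])`: probability distributions on `[0,1]` with the Lévy–Prokhorov metric, which
induces the topology of weak convergence. -/
abbrev TypeDist := LevyProkhorov (ProbabilityMeasure unitInterval)

/-- `D(𝓜([0,1]), [0,T])`. -/
abbrev TypePath (T : ℝ) := CadlagPath T TypeDist

/-- The empirical distribution `n⁻¹ ∑ᵢ δ_{xᵢ}`. -/
def empDist {n : ℕ+} (x : Fin n → unitInterval) : TypeDist :=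
  LevyProkhorov.ofMeasure ⟨((n : ℕ) : ℝ≥0∞)⁻¹ • ∑ i, Measure.dirac (x i), ⟨by
    simp [ENNReal.inv_mul_cancel]⟩⟩

/-- The distribution function `x ↦ F([0,x])`. -/
def TypeDist.cdf (F : TypeDist) (x : unitInterval) : ℝ := (F.toMeasure : Measure unitInterval).real (Iic x)

/-- The set whose infimum is the generalised inverse. The point `1` belongs to
`{x : F(x) > u}` for every `u < 1`; it is inserted to give the value `1` at `u = 1`. -/
def TypeDist.invSet (F : TypeDist) (u : ℝ) : Set ℝ :=
  insert 1 {x : ℝ | ∃ hx : x ∈ Icc (0 : ℝ) 1, u < F.cdf ⟨x, hx⟩}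

lemma TypeDist.invSet_subset (F : TypeDist) (u : ℝ) : F.invSet u ⊆ Icc 0 1 := by
  rintro x (rfl | ⟨hx, -⟩)
  · exact ⟨zero_le_one, le_rfl⟩
  · exact hx

/-- The right-continuous generalised inverse `F̄(u) = inf {x ∈ [0,1] : F(x) > u}`. -/
def TypeDist.inv (F : TypeDist) (u : unitInterval) : unitInterval :=
  ⟨sInf (F.invSet u), Real.sInf_nonneg fun _ hx => (F.invSet_subset _ hx).1,
    csInf_le ⟨0, fun _ hx => (F.invSet_subset _ hx).1⟩ (mem_insert _ _)⟩

lemma TypeDist.inv_mono (F : TypeDist) : Monotone F.inv := by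
  intro u v huv
  refine Subtype.mk_le_mk.2 (csInf_le_csInf ⟨0, fun _ hx => (F.invSet_subset _ hx).1⟩
    ⟨1, mem_insert _ _⟩ (insert_subset_insert ?_))
  rintro x ⟨hx, h⟩
  exact ⟨hx, lt_of_le_of_lt huv h⟩

/-- An edge-connection function
`H : [0,T] × [0,1]² × D(𝓜([0,1]), [0,T]) → [0,1]`, symmetric and measurable in the two types. -/
structure ConnFun (T : ℝ) where
  toFun : Icc (0 : ℝ) T → unitInterval → unitInterval → TypePath T → unitInterval
  symm : ∀ t x y F, toFun t x y F = toFun t y x F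
  meas : ∀ t F, Measurable fun p : unitInterval × unitInterval => toFun t p.1 p.2 F

/-- The induced reference graphon process
`g^{[F]}(t; x, y) = H(t; F̄(t; x), F̄(t; y), F)`. -/
def ConnFun.refGraphon {T : ℝ} (H : ConnFun T) (F : TypePath T) (t : Icc (0 : ℝ) T) : Kern where
  toFun x y := H.toFun t ((F.toFun t).inv x) ((F.toFun t).inv y) F
  symm _ _ := H.symm t _ _ F
  meas := (H.meas t F).comp (((F.toFun t).inv_mono.measurable.comp measurable_fst).prodMk
    ((F.toFun t).inv_mono.measurable.comp measurable_snd))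

/-- The map `F ↦ g^{[F]}` is a continuous map from `D(𝓜([0,1]), [0,T])` to
`D((𝒲, ‖·‖_{L¹}), [0,T])`. -/
def ConnFun.InducesContinuousMap {T : ℝ} (H : ConnFun T) : Prop :=
  ∃ Φ : TypePath T → CadlagPath T GraphonL1, Continuous Φ ∧
    ∀ F t, (Φ F).toFun t = (H.refGraphon F t).toL1

/-! ## The graph-valued process -/

/-- The data of the dynamic random graphs: for each `n`, types `X n i t` of the `n` vertices and
a random graph `G n t` on `n` vertices, defined on a probability space `(Ω n, P n)`, such that

* the process `μ_n(t) = n⁻¹ ∑ᵢ δ_{Xᵢ(t)}` has càdlàg paths `F n`;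
* at each time `t`, conditionally on the types `Xᵢ(t)` and on the whole path `F n`, distinct
  edges are independent and edge `ij` is active with probability `H(t; Xᵢ(t), Xⱼ(t), F n)`.

Nothing is required of the joint law of the graph at different times. -/
structure IsDynamicGraph {T : ℝ} (H : ConnFun T) {Ω : ℕ+ → Type*}
    [∀ n, MeasurableSpace (Ω n)] (P : ∀ n, Measure (Ω n))
    (X : ∀ n : ℕ+, Fin n → Icc (0 : ℝ) T → Ω n → unitInterval)
    (F : ∀ n : ℕ+, Ω n → TypePath T)
    (G : ∀ n : ℕ+, Icc (0 : ℝ) T → Ω n → SimpleGraph (Fin n)) : Prop where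
  measurable_type : ∀ n i t, Measurable (X n i t)
  path_eq : ∀ n ω t, (F n ω).toFun t = empDist fun i => X n i t ω
  measurable_edge : ∀ n t i j, MeasurableSet {ω | (G n t ω).Adj i j}
  edge_law : ∀ (n : ℕ+) t (g : SimpleGraph (Fin n)) [DecidableRel g.Adj],
    (P n)[{ω | G n t ω = g}.indicator (fun _ => (1 : ℝ)) |
        (⨆ i, MeasurableSpace.comap (X n i t) inferInstance) ⊔
          ⨆ s, MeasurableSpace.comap (fun ω => ((F n ω).toFun s).toMeasure) inferInstance]
      =ᵐ[P n] fun ω => ∏ e : Fin n × Fin n with e.1 < e.2,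
        if g.Adj e.1 e.2 then (H.toFun t (X n e.1 t ω) (X n e.2 t ω) (F n ω) : ℝ)
        else 1 - H.toFun t (X n e.1 t ω) (X n e.2 t ω) (F n ω)

/-! ## Large deviation principles -/

/-- Rate functions: not identically `∞`, lower semicontinuous, with compact level sets. -/
structure IsRateFunction {E : Type*} [TopologicalSpace E] (J : E → ℝ≥0∞) : Prop where
  proper : ∃ x, J x ≠ ∞
  lsc : LowerSemicontinuous J
  compact_level : ∀ a : ℝ≥0∞, a ≠ ∞ → IsCompact {x | J x ≤ a}

/-- The random elements `Z n` of `E` satisfy the large deviation principle with rate `ℓ n` and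
rate function `J`. If `{Z n ∈ C}` or `{Z n ∈ O}` is not measurable, its outer probability is used
in the upper bound and its inner probability `1 - P (complement)` in the lower bound. -/
structure SatisfiesLDP {Ω : ℕ+ → Type*} [∀ n, MeasurableSpace (Ω n)] (P : ∀ n, Measure (Ω n))
    {E : Type*} [TopologicalSpace E] (Z : ∀ n, Ω n → E) (ℓ : ℕ+ → ℝ) (J : E → ℝ≥0∞) : Prop where
  rate_tendsto : Tendsto ℓ atTop atTop
  rateFunction : IsRateFunction J
  upper : ∀ C : Set E, IsClosed C →
    limsup (fun n => ((1 / ℓ n : ℝ) : EReal) * ENNReal.log (P n {ω | Z n ω ∈ C})) atTop ≤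
      -((⨅ x ∈ C, J x : ℝ≥0∞) : EReal)
  lower : ∀ O : Set E, IsOpen O →
    -((⨅ x ∈ O, J x : ℝ≥0∞) : EReal) ≤
      liminf (fun n => ((1 / ℓ n : ℝ) : EReal) * ENNReal.log (1 - P n {ω | Z n ω ∉ O})) atTop

/-- `J_S(h) = inf {K(F) : g̃^{[F]}(t) = h(t) for all t ∈ S}`. -/
def contractedRate {T : ℝ} (H : ConnFun T) (K : TypePath T → ℝ≥0∞) (S : Set (Icc (0 : ℝ) T))
    (h : S → UGraphon) : ℝ≥0∞ :=
  ⨅ (F : TypePath T) (_ : ∀ t : S, (H.refGraphon F t).tilde = h t), K F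

end

/-!
The proof combines a contraction principle with an exponential equivalence.

*Contraction.* If `Fₖ → F` in the Skorokhod topology, then (CP) gives time changes `θₖ → id` such
that `g^{[Fₖ]}(t)` is `L¹`-close to `g^{[F]}(θₖ t)`. The cut metric is bounded by the `L¹` distance,
so evaluation at `t` of the unlabelled reference graphon is continuous at `F` as soon as the path of
`F` does not jump at `t`, or `t = T`, which every time change fixes
(`ConnFun.InducesContinuousMap.continuousAt_tilde`). Hence `F ↦ (g̃^{[F]}(t))_{t ∈ S}` is continuous
at every `F` of finite rate. This is enough for the contraction principle: its proof only meets
level sets of `K` and neighbourhoods of points of finite rate.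

*Exponential equivalence.* Fix `t`. Sort the vertices by type; on each cell `(k/n, (k+1)/n]` the
generalised inverse of the empirical distribution equals the order statistic with index `k`
(`TypeDist.inv_empDist`). After the corresponding rearrangement of the cells, which is a
measure-preserving bijection (`cellPerm`), the empirical graphon and the reference graphon are step
kernels on the same cells. Their cut distance is therefore a bilinear form in the deviations
`1{ij ∈ G} - H(t; Xᵢ, Xⱼ, F)` with coefficients in a cube, and is bounded by its values at the `4 ^ n`
pairs of sign vectors (`cutMetric_empGraphon_le`). For each pair of sign vectors the Chernoff bound,
conditionally on the types and the path, gives a probability at most `exp (-c ε² n²)`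
(`HasCondIndepEdges.measure_sgn_ge_le`). The union bound keeps the order `n²` in the exponent, which
beats the rate `ℓ n = o(n²)` (`IsDynamicGraph.exp_close`). No joint law over several times is needed,
because an entourage of the product uniformity constrains finitely many times
(`IsDynamicGraph.exp_close_pi`).

`SatisfiesLDP.of_exponentially_equivalent` combines the two parts. It works in a uniform space since
the product over an uncountable `S` is not metrizable.
-/

/-! ### Large deviation bounds in exponential form -/

lemma log_div_le_iff {l : ℝ} (hl : 0 < l) (p : ℝ≥0∞) (a : ℝ) :
    ((1 / l : ℝ) : EReal) * ENNReal.log p ≤ ((-a : ℝ) : EReal) ↔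
      p ≤ ENNReal.ofReal (Real.exp (-a * l)) := by
  have h1 : ENNReal.ofReal (Real.exp (-a * l)) = EReal.exp ((-a * l : ℝ) : EReal) := by
    rw [EReal.exp_coe]
  rw [h1, ← ENNReal.log_le_log_iff, EReal.log_exp, mul_comm ((1 / l : ℝ) : EReal), one_div]
  have h2 : ENNReal.log p * ((l⁻¹ : ℝ) : EReal) = ENNReal.log p / (l : EReal) := by
    rw [EReal.coe_inv]; rfl
  rw [h2, EReal.div_le_iff_le_mul (by exact_mod_cast hl) (EReal.coe_ne_top _)]
  rw [EReal.coe_mul, mul_comm]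

lemma le_log_div_iff {l : ℝ} (hl : 0 < l) (p : ℝ≥0∞) (a : ℝ) :
    ((-a : ℝ) : EReal) ≤ ((1 / l : ℝ) : EReal) * ENNReal.log p ↔
      ENNReal.ofReal (Real.exp (-a * l)) ≤ p := by
  have h1 : ENNReal.ofReal (Real.exp (-a * l)) = EReal.exp ((-a * l : ℝ) : EReal) := by
    rw [EReal.exp_coe]
  rw [h1, ← ENNReal.log_le_log_iff, EReal.log_exp, mul_comm ((1 / l : ℝ) : EReal), one_div]
  have h2 : ENNReal.log p * ((l⁻¹ : ℝ) : EReal) = ENNReal.log p / (l : EReal) := by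
    rw [EReal.coe_inv]; rfl
  rw [h2, EReal.le_div_iff_mul_le (by exact_mod_cast hl) (EReal.coe_ne_top _)]
  rw [EReal.coe_mul]

/-- The upper large deviation bound says that the probabilities are eventually at most
`exp (-a ℓ)`, for every real `a` below the claimed exponent. -/
lemma limsup_log_div_le_iff {ℓ : ℕ+ → ℝ} (hℓ : Tendsto ℓ atTop atTop) (p : ℕ+ → ℝ≥0∞)
    (β : EReal) :
    limsup (fun n => ((1 / ℓ n : ℝ) : EReal) * ENNReal.log (p n)) atTop ≤ -β ↔
      ∀ a : ℝ, (a : EReal) < β →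
        ∀ᶠ n in atTop, p n ≤ ENNReal.ofReal (Real.exp (-a * ℓ n)) := by
  constructor
  · intro h a ha
    have h1 := eventually_lt_of_limsup_lt (h.trans_lt (EReal.neg_lt_neg_iff.2 ha))
    filter_upwards [h1, hℓ.eventually_gt_atTop 0] with n hn hn0
    exact (log_div_le_iff hn0 _ _).1 (by simpa using hn.le)
  · intro h
    refine EReal.le_of_forall_lt_iff_le.1 fun c hc => ?_
    have hc' : ((-c : ℝ) : EReal) < β := by
      rw [EReal.coe_neg]; exact EReal.neg_lt_comm.1 hc
    refine limsup_le_of_le (h := ?_)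
    filter_upwards [h (-c) hc', hℓ.eventually_gt_atTop 0] with n hn hn0
    simpa using (log_div_le_iff hn0 _ _).2 hn

/-- The lower large deviation bound says that the probabilities are eventually at least
`exp (-a ℓ)`, for every real `a` above the claimed exponent. -/
lemma le_liminf_log_div_iff {ℓ : ℕ+ → ℝ} (hℓ : Tendsto ℓ atTop atTop) (p : ℕ+ → ℝ≥0∞)
    (β : EReal) :
    -β ≤ liminf (fun n => ((1 / ℓ n : ℝ) : EReal) * ENNReal.log (p n)) atTop ↔
      ∀ a : ℝ, β < a →
        ∀ᶠ n in atTop, ENNReal.ofReal (Real.exp (-a * ℓ n)) ≤ p n := by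
  constructor
  · intro h a ha
    have h1 := eventually_lt_of_lt_liminf ((EReal.neg_lt_neg_iff.2 ha).trans_le h)
    filter_upwards [h1, hℓ.eventually_gt_atTop 0] with n hn hn0
    exact (le_log_div_iff hn0 _ _).1 (by simpa using hn.le)
  · intro h
    refine EReal.ge_of_forall_gt_iff_ge.1 fun c hc => ?_
    have hc' : β < ((-c : ℝ) : EReal) := by
      rw [EReal.coe_neg]; exact EReal.lt_neg_comm.1 hc
    refine le_liminf_of_le (h := ?_)
    filter_upwards [h (-c) hc', hℓ.eventually_gt_atTop 0] with n hn hn0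
    simpa using (le_log_div_iff hn0 _ _).2 hn

/-- A factor `2` is absorbed by an arbitrarily small loss in the exponent. -/
lemma eventually_two_mul_exp_le {ℓ : ℕ+ → ℝ} (hℓ : Tendsto ℓ atTop atTop) {a b : ℝ} (hab : a < b) :
    ∀ᶠ n in atTop, ENNReal.ofReal (Real.exp (-b * ℓ n)) + ENNReal.ofReal (Real.exp (-b * ℓ n)) ≤
      ENNReal.ofReal (Real.exp (-a * ℓ n)) := by
  filter_upwards [hℓ.eventually_ge_atTop (1 / (b - a))] with n hn
  have h1 : 1 ≤ (b - a) * ℓ n := by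
    rwa [div_le_iff₀' (by linarith)] at hn
  rw [← ENNReal.ofReal_add (Real.exp_pos _).le (Real.exp_pos _).le]
  refine ENNReal.ofReal_le_ofReal ?_
  have h2 : Real.exp (-a * ℓ n) = Real.exp (-b * ℓ n) * Real.exp ((b - a) * ℓ n) := by
    rw [← Real.exp_add]; ring_nf
  have h3 := Real.add_one_le_exp ((b - a) * ℓ n)
  rw [h2]
  nlinarith [Real.exp_pos (-b * ℓ n)]

/-! ### Contraction and exponential equivalence -/

section Transfer

variable {E U : Type*} [TopologicalSpace E] [UniformSpace U]

/-- The infimum defining a contracted rate function is attained at finite levels, so its level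
sets are the images of the level sets of the original rate function. -/
lemma IsRateFunction.setOf_contracted_le [T1Space U] {K : E → ℝ≥0∞} (hK : IsRateFunction K)
    {Ψ : E → U} (hΨ : ∀ x, K x ≠ ∞ → ContinuousAt Ψ x) {a : ℝ≥0∞} (ha : a ≠ ∞) :
    {u | (⨅ (x) (_ : Ψ x = u), K x) ≤ a} = Ψ '' {x | K x ≤ a} := by
  ext u
  constructor
  · intro hu
    have hu' : (⨅ (x) (_ : Ψ x = u), K x) ≤ a := hu
    have ha1 : a + 1 ≠ ∞ := by simp [ha]
    have hcl : IsClosed {x | K x ≤ a + 1} := hK.lsc.isClosed_preimage (a + 1)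
    have hcont : ContinuousOn Ψ {x | K x ≤ a + 1} := fun x hx =>
      (hΨ x (ne_top_of_le_ne_top ha1 hx)).continuousWithinAt
    have hB : IsCompact ({x | K x ≤ a + 1} ∩ Ψ ⁻¹' {u}) :=
      (hK.compact_level _ ha1).of_isClosed_subset
        (hcont.preimage_isClosed_of_isClosed hcl isClosed_singleton) inter_subset_left
    have hne : ({x | K x ≤ a + 1} ∩ Ψ ⁻¹' {u}).Nonempty := by
      obtain ⟨x, hx⟩ := iInf_lt_iff.1 (hu'.trans_lt (ENNReal.lt_add_right ha one_ne_zero))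
      obtain ⟨hxu, hx⟩ := iInf_lt_iff.1 hx
      exact ⟨x, hx.le, hxu⟩
    obtain ⟨x, hx, hmin⟩ := (hK.lsc.lowerSemicontinuousOn _).exists_isMinOn hne hB
    refine ⟨x, (le_iInf₂ fun y hy => ?_).trans hu', hx.2⟩
    by_cases hy1 : K y ≤ a + 1
    · exact hmin ⟨hy1, hy⟩
    · exact hx.1.trans (not_le.1 hy1).le
  · rintro ⟨x, hx, rfl⟩
    exact iInf₂_le_of_le (f := fun x _ => K x) x rfl hx

lemma IsRateFunction.contracted [T2Space U] {K : E → ℝ≥0∞} (hK : IsRateFunction K)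
    {Ψ : E → U} (hΨ : ∀ x, K x ≠ ∞ → ContinuousAt Ψ x) :
    IsRateFunction fun u => ⨅ (x) (_ : Ψ x = u), K x := by
  have hc : ∀ a : ℝ≥0∞, a ≠ ∞ → IsCompact {u | (⨅ (x) (_ : Ψ x = u), K x) ≤ a} := by
    intro a ha
    rw [hK.setOf_contracted_le hΨ ha]
    refine (hK.compact_level a ha).image_of_continuousOn fun x hx => ?_
    exact (hΨ x (ne_top_of_le_ne_top ha hx)).continuousWithinAt
  refine ⟨?_, ?_, hc⟩
  · obtain ⟨x, hx⟩ := hK.proper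
    exact ⟨Ψ x, ne_top_of_le_ne_top hx (iInf₂_le_of_le x rfl le_rfl)⟩
  · rw [lowerSemicontinuous_iff_isClosed_preimage]
    intro a
    rcases eq_or_ne a ∞ with rfl | ha
    · simp
    · exact (hc a ha).isClosed

variable {Ω : ℕ+ → Type*} [∀ n, MeasurableSpace (Ω n)] {P : ∀ n, Measure (Ω n)}
  {Y : ∀ n, Ω n → E} {Z : ∀ n, Ω n → U} {ℓ : ℕ+ → ℝ} {K : E → ℝ≥0∞} {Ψ : E → U}

/-- Let `Y n` satisfy the large deviation principle with rate function `K`, let `Ψ` be continuous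
at each point where `K` is finite, and let `Z n` be exponentially equivalent to `Ψ (Y n)`. Then
`Z n` satisfies the large deviation principle with the contracted rate function. -/
theorem SatisfiesLDP.of_exponentially_equivalent [T2Space U] [∀ n, IsProbabilityMeasure (P n)]
    (h : SatisfiesLDP P Y ℓ K) (hΨ : ∀ x, K x ≠ ∞ → ContinuousAt Ψ x)
    (hZ : ∀ V ∈ uniformity U, ∀ a : ℝ, ∀ᶠ n in atTop,
      P n {ω | (Ψ (Y n ω), Z n ω) ∉ V} ≤ ENNReal.ofReal (Real.exp (-a * ℓ n))) :
    SatisfiesLDP P Z ℓ fun u => ⨅ (x) (_ : Ψ x = u), K x := by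
  refine ⟨h.rate_tendsto, h.rateFunction.contracted hΨ, fun C hC => ?_, fun O hO => ?_⟩
  · rw [limsup_log_div_le_iff h.rate_tendsto]
    intro a ha
    obtain ⟨b, hab, hb⟩ := EReal.lt_iff_exists_real_btwn.1 ha
    obtain ⟨c, hbc, hc⟩ := EReal.lt_iff_exists_real_btwn.1 hb
    have hab : a < b := EReal.coe_lt_coe_iff.1 hab
    have hbc : b < c := EReal.coe_lt_coe_iff.1 hbc
    have hle : ∀ y : ℝ≥0∞, (y : EReal) ≤ (c : EReal) → y ≠ ∞ := by
      rintro y hy rfl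
      exact absurd hy (not_le.2 (EReal.coe_lt_top c))
    -- the level set of `K` at height `c`; it is empty when `c < 0`
    let L : Set E := {x | (K x : EReal) ≤ c}
    have hL : IsCompact L := by
      rcases lt_or_ge c 0 with hc0 | hc0
      · have : L = ∅ := by
          refine eq_empty_of_forall_notMem fun x hx => ?_
          have h1 : ((0 : ℝ) : EReal) ≤ (c : EReal) :=
            le_trans (EReal.coe_ennreal_nonneg (K x)) hx
          exact absurd (EReal.coe_le_coe_iff.1 h1) (not_le.2 hc0)
        rw [this]; exact isCompact_empty
      · have : L = {x | K x ≤ ENNReal.ofReal c} := by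
          ext x
          change (K x : EReal) ≤ (c : EReal) ↔ K x ≤ ENNReal.ofReal c
          rw [← EReal.coe_ennreal_le_coe_ennreal_iff, EReal.coe_ennreal_ofReal, max_eq_left hc0]
        rw [this]
        exact h.rateFunction.compact_level _ ENNReal.ofReal_ne_top
    have hΨL : ∀ x ∈ L, ContinuousAt Ψ x := fun x hx => hΨ x (hle _ hx)
    have hQ : IsCompact (Ψ '' L) :=
      hL.image_of_continuousOn fun x hx => (hΨL x hx).continuousWithinAt
    have hdisj : Disjoint (Ψ '' L) C := by
      rw [Set.disjoint_left]
      rintro _ ⟨x, hx, rfl⟩ hxC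
      refine absurd hc (not_lt.2 (le_trans ?_ hx))
      exact EReal.coe_ennreal_le_coe_ennreal_iff.2
        (iInf₂_le_of_le (Ψ x) hxC (iInf₂_le_of_le x rfl le_rfl))
    obtain ⟨V, hV, hVd⟩ := hdisj.exists_uniform_thickening hQ hC
    -- a point of `D` with rate at most `c` would be a continuity point of `Ψ` whose image lies in
    -- the compact set `Ψ '' L`, so that nearby points could not leave the thickening of `Ψ '' L`
    let D : Set E := closure {x | Ψ x ∉ ⋃ q ∈ Ψ '' L, UniformSpace.ball q V}
    have hD : (b : EReal) < ((⨅ x ∈ D, K x : ℝ≥0∞) : EReal) := by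
      refine lt_of_lt_of_le (EReal.coe_lt_coe_iff.2 hbc) ?_
      by_contra hlt
      rw [not_le] at hlt
      lift (⨅ x ∈ D, K x) to NNReal using hle _ hlt.le with r hr
      have hr' : (⨅ x ∈ D, K x) < ENNReal.ofReal c := by
        rw [← hr, ← EReal.coe_ennreal_lt_coe_ennreal_iff, EReal.coe_ennreal_ofReal]
        exact hlt.trans_le (EReal.coe_le_coe_iff.2 (le_max_left _ _))
      obtain ⟨x, hx⟩ := iInf_lt_iff.1 hr'
      obtain ⟨hxD, hx⟩ := iInf_lt_iff.1 hx
      have hc0 : 0 ≤ c := by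
        by_contra hc0
        rw [ENNReal.ofReal_of_nonpos (not_le.1 hc0).le] at hx
        exact absurd hx not_lt_zero
      have hxL : x ∈ L := by
        have := EReal.coe_ennreal_le_coe_ennreal_iff.2 hx.le
        rwa [EReal.coe_ennreal_ofReal, max_eq_left hc0] at this
      have hnhds := (hΨL x hxL).preimage_mem_nhds (UniformSpace.ball_mem_nhds (Ψ x) hV)
      obtain ⟨z, hz1, hz2⟩ := mem_closure_iff_nhds.1 hxD _ hnhds
      exact hz2 (mem_iUnion₂.2 ⟨Ψ x, mem_image_of_mem _ hxL, hz1⟩)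
    have h1 := (limsup_log_div_le_iff h.rate_tendsto _ _).1 (h.upper D isClosed_closure) b hD
    filter_upwards [h1, hZ _ (symm_le_uniformity hV) b,
      eventually_two_mul_exp_le h.rate_tendsto hab] with n hn1 hn2 hn3
    refine le_trans (measure_mono (t := {ω | Y n ω ∈ D} ∪
      {ω | (Ψ (Y n ω), Z n ω) ∉ Prod.swap ⁻¹' V}) fun ω hω => ?_)
      ((measure_union_le _ _).trans ((add_le_add hn1 hn2).trans hn3))
    by_contra hcon
    simp only [mem_union, mem_ofPred_eq, not_or, not_not] at hcon
    refine hcon.1 (subset_closure fun hmem => ?_)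
    exact Set.disjoint_left.1 hVd hmem (mem_iUnion₂.2 ⟨Z n ω, hω, hcon.2⟩)
  · rw [le_liminf_log_div_iff h.rate_tendsto]
    intro a ha
    have hpos : (0 : ℝ) < a := by
      have h0 : ((0 : ℝ) : EReal) < a :=
        lt_of_le_of_lt (EReal.coe_ennreal_nonneg _) ha
      exact EReal.coe_lt_coe_iff.1 h0
    have ha' : (⨅ u ∈ O, ⨅ (x) (_ : Ψ x = u), K x) < ENNReal.ofReal a := by
      rwa [← EReal.coe_ennreal_lt_coe_ennreal_iff, EReal.coe_ennreal_ofReal, max_eq_left hpos.le]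
    obtain ⟨u, hu⟩ := iInf_lt_iff.1 ha'
    obtain ⟨huO, hu⟩ := iInf_lt_iff.1 hu
    obtain ⟨x, hx⟩ := iInf_lt_iff.1 hu
    obtain ⟨hxu, hxK⟩ := iInf_lt_iff.1 hx
    subst hxu
    have hxa : ((K x : ℝ≥0∞) : EReal) < a := by
      have hx' := EReal.coe_ennreal_lt_coe_ennreal_iff.2 hxK
      rwa [EReal.coe_ennreal_ofReal, max_eq_left hpos.le] at hx'
    obtain ⟨b, hxb, hba⟩ := EReal.lt_iff_exists_real_btwn.1 hxa
    have hba : b < a := EReal.coe_lt_coe_iff.1 hba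
    -- `Ψ` is continuous at `x`, so `Y n` in the neighbourhood `N` of `x` forces `Ψ (Y n)` to lie
    -- well inside `O`, and `Z n` to lie in `O` unless it is far from `Ψ (Y n)`
    obtain ⟨V, hV, hVO⟩ := UniformSpace.mem_nhds_iff.1 (hO.mem_nhds huO)
    obtain ⟨W, hW, hWV⟩ := comp_mem_uniformity_sets hV
    let N : Set E := interior (Ψ ⁻¹' UniformSpace.ball (Ψ x) W)
    have hxN : x ∈ N := mem_interior_iff_mem_nhds.2
      ((hΨ x hxK.ne_top).preimage_mem_nhds (UniformSpace.ball_mem_nhds _ hW))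
    have hN : ((⨅ y ∈ N, K y : ℝ≥0∞) : EReal) < b :=
      lt_of_le_of_lt (EReal.coe_ennreal_le_coe_ennreal_iff.2 (iInf₂_le x hxN)) hxb
    have h1 := (le_liminf_log_div_iff h.rate_tendsto _ _).1 (h.lower N isOpen_interior) b hN
    filter_upwards [h1, hZ W hW a, eventually_two_mul_exp_le h.rate_tendsto hba] with n hn1 hn2 hn3
    have hsub : P n {ω | Z n ω ∉ O} ≤ P n {ω | Y n ω ∉ N} + P n {ω | (Ψ (Y n ω), Z n ω) ∉ W} := by
      refine (measure_mono fun ω hω => ?_).trans (measure_union_le _ _)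
      by_contra hcon
      simp only [mem_union, mem_ofPred_eq, not_or, not_not] at hcon
      have hYN : Ψ (Y n ω) ∈ UniformSpace.ball (Ψ x) W := interior_subset (s := Ψ ⁻¹' _) hcon.1
      exact hω (hVO (hWV (SetRel.prodMk_mem_comp hYN hcon.2)))
    refine le_trans ?_ (tsub_le_tsub_left hsub 1)
    rw [← tsub_tsub]
    refine le_trans ?_ (tsub_le_tsub hn1 hn2)
    exact ENNReal.le_sub_of_add_le_left ENNReal.ofReal_ne_top hn3

end Transfer

/-! ### Random graphs with conditionally independent edges -/

/-- The deviation at the pair `ij`: the edge indicator of `g` minus the edge probability `w i j`.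
On the diagonal the edge indicator vanishes, so that the value there is `-w i i`. -/
noncomputable def edgeDev {n : ℕ} (g : SimpleGraph (Fin n)) (w : Fin n → Fin n → ℝ)
    (i j : Fin n) : ℝ :=
  open scoped Classical in (if g.Adj i j then 1 else 0) - w i j

lemma edgeDev_comm {n : ℕ} (g : SimpleGraph (Fin n)) {w : Fin n → Fin n → ℝ}
    (hw : ∀ i j, w i j = w j i) (i j : Fin n) : edgeDev g w i j = edgeDev g w j i := by
  unfold edgeDev
  rw [hw i j]
  simp only [sub_left_inj]
  by_cases h : g.Adj i j
  · rw [if_pos h, if_pos h.symm]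
  · rw [if_neg h, if_neg fun h' => h h'.symm]

lemma abs_edgeDev_le {n : ℕ} (g : SimpleGraph (Fin n)) {w : Fin n → Fin n → ℝ}
    (hw : ∀ i j, w i j ∈ Icc (0 : ℝ) 1) (i j : Fin n) : |edgeDev g w i j| ≤ 1 := by
  have := hw i j
  unfold edgeDev
  rw [abs_le]
  split_ifs <;> constructor <;> linarith [this.1, this.2]

/-- A bound on the moment generating function of a centred Bernoulli variable. -/
lemma bernoulli_mgf_le {w s : ℝ} (hw : w ∈ Icc (0 : ℝ) 1) (hs : |s| ≤ 1) :
    w * Real.exp (s * (1 - w)) + (1 - w) * Real.exp (s * (0 - w)) ≤ Real.exp (s ^ 2) := by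
  obtain ⟨h0, h1⟩ := hw
  have key : ∀ x : ℝ, |x| ≤ 1 → Real.exp (s * x) ≤ 1 + s * x + s ^ 2 := by
    intro x hx
    have h2 : |s * x| ≤ 1 := by
      rw [abs_mul]; exact mul_le_one₀ hs (abs_nonneg _) hx
    have h3 := (abs_le.1 (Real.abs_exp_sub_one_sub_id_le h2)).2
    have h4 : x ^ 2 ≤ 1 := by
      rw [← sq_abs]; exact pow_le_one₀ (abs_nonneg _) hx
    nlinarith [sq_nonneg s]
  have ha := key (1 - w) (abs_le.2 ⟨by linarith, by linarith⟩)
  have hb := key (0 - w) (abs_le.2 ⟨by linarith, by linarith⟩)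
  have hc := Real.add_one_le_exp (s ^ 2)
  nlinarith [mul_le_mul_of_nonneg_left ha h0, mul_le_mul_of_nonneg_left hb (sub_nonneg.2 h1)]

/-- Pairs `(i, j)` with `i < j`, which index the potential edges. -/
abbrev edgePairs (n : ℕ) : Finset (Fin n × Fin n) := Finset.univ.filter fun e => e.1 < e.2

open scoped Classical in
/-- A graph on `Fin n` is a free choice of edges among the pairs `i < j`, so that a sum over
graphs of products over pairs factorises. -/
lemma sum_graph_prod (n : ℕ) (a b : Fin n × Fin n → ℝ) :
    ∑ g : SimpleGraph (Fin n), ∏ e ∈ edgePairs n, (if g.Adj e.1 e.2 then a e else b e) =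
      ∏ e ∈ edgePairs n, (a e + b e) := by
  rw [Finset.prod_add]
  refine Finset.sum_bij' (fun g _ => (edgePairs n).filter fun e => g.Adj e.1 e.2)
    (fun s _ => SimpleGraph.fromRel fun i j => (i, j) ∈ s) ?_ ?_ ?_ ?_ ?_
  · intro g _
    exact Finset.mem_powerset.2 (Finset.filter_subset _ _)
  · intros; exact Finset.mem_univ _
  · intro g _
    ext i j
    simp only [SimpleGraph.fromRel_adj, Finset.mem_filter, Finset.mem_univ, true_and]
    constructor
    · rintro ⟨-, h | h⟩
      · exact h.2
      · exact h.2.symm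
    · intro h
      refine ⟨h.ne, ?_⟩
      rcases lt_or_gt_of_ne h.ne with hij | hij
      · exact Or.inl ⟨hij, h⟩
      · exact Or.inr ⟨hij, h.symm⟩
  · intro s hs
    have hs' := Finset.mem_powerset.1 hs
    ext ⟨i, j⟩
    simp only [SimpleGraph.fromRel_adj, Finset.mem_filter, Finset.mem_univ, true_and]
    constructor
    · rintro ⟨hij, -, h | h⟩
      · exact h
      · exact absurd (Finset.mem_filter.1 (hs' h)).2 (not_lt.2 hij.le)
    · intro h
      have hij := (Finset.mem_filter.1 (hs' h)).2
      exact ⟨hij, hij.ne, Or.inl h⟩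
  · intro g _
    rw [Finset.prod_ite, Finset.filter_not]

/-- Splitting according to the value of the random graph separates the graph, which is averaged
conditionally, from the edge probabilities, which are known. -/
lemma exp_sum_edgeDev_eq_sum {Ω : Type*} {n : ℕ} (Gr : Ω → SimpleGraph (Fin n))
    (w : Ω → Fin n → Fin n → ℝ) (c : Fin n × Fin n → ℝ) (ω : Ω) :
    Real.exp (∑ e ∈ edgePairs n, c e * edgeDev (Gr ω) (w ω) e.1 e.2) =
      open scoped Classical in
      ∑ g : SimpleGraph (Fin n), {ω | Gr ω = g}.indicator (fun _ => (1 : ℝ)) ω *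
        Real.exp (∑ e ∈ edgePairs n, c e * edgeDev g (w ω) e.1 e.2) := by
  classical
  rw [Finset.sum_eq_single (Gr ω)]
  · simp
  · intro g _ hg
    simp [hg.symm]
  · simp

/-- Given the information `m`, the random graph `Gr` has independent edges, and `ij` is an edge
with probability `w ω i j`. The conditional law is given through its point masses. The measurability
of `w` is not assumed: off the diagonal it follows from `law`. -/
structure HasCondIndepEdges {Ω : Type*} (m : MeasurableSpace Ω) [MeasurableSpace Ω] (P : Measure Ω)
    {n : ℕ} (Gr : Ω → SimpleGraph (Fin n)) (w : Ω → Fin n → Fin n → ℝ) : Prop where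
  measurable_edge : ∀ i j, MeasurableSet {ω | (Gr ω).Adj i j}
  mem_Icc : ∀ ω i j, w ω i j ∈ Icc (0 : ℝ) 1
  symm : ∀ ω i j, w ω i j = w ω j i
  law : ∀ (g : SimpleGraph (Fin n)) [DecidableRel g.Adj],
    P[{ω | Gr ω = g}.indicator (fun _ => (1 : ℝ)) | m] =ᵐ[P] fun ω =>
      ∏ e ∈ edgePairs n, if g.Adj e.1 e.2 then w ω e.1 e.2 else 1 - w ω e.1 e.2

namespace HasCondIndepEdges

variable {Ω : Type*} {m : MeasurableSpace Ω} [m0 : MeasurableSpace Ω] {P : Measure Ω}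
  {n : ℕ} {Gr : Ω → SimpleGraph (Fin n)} {w : Ω → Fin n → Fin n → ℝ}

lemma measurableSet_eq (h : HasCondIndepEdges m P Gr w) (g : SimpleGraph (Fin n)) :
    MeasurableSet {ω | Gr ω = g} := by
  have : {ω | Gr ω = g} = ⋂ i, ⋂ j, {ω | (Gr ω).Adj i j ↔ g.Adj i j} := by
    ext ω
    simp [SimpleGraph.ext_iff, funext_iff]
  rw [this]
  refine MeasurableSet.iInter fun i => MeasurableSet.iInter fun j => ?_
  by_cases hg : g.Adj i j
  · simpa [hg] using h.measurable_edge i j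
  · simp only [hg, iff_false]
    exact (h.measurable_edge i j).compl

/-- If `m` were not a sub-σ-algebra, its conditional expectations would all be `0`, whereas the
conditional probabilities of the graphs add up to `1`. -/
lemma le [IsProbabilityMeasure P] (h : HasCondIndepEdges m P Gr w) : m ≤ m0 := by
  classical
  by_contra hm
  have h1 : ∀ᵐ ω ∂P, ∀ g : SimpleGraph (Fin n),
      ∏ e ∈ edgePairs n, (if g.Adj e.1 e.2 then w ω e.1 e.2 else 1 - w ω e.1 e.2) = 0 := by
    rw [ae_all_iff]
    intro g
    filter_upwards [h.law g] with ω hω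
    rw [← hω, condExp_of_not_le hm]
    rfl
  obtain ⟨ω, hω⟩ := h1.exists
  have h2 := sum_graph_prod n (fun e => w ω e.1 e.2) (fun e => 1 - w ω e.1 e.2)
  simp [hω] at h2

/-- The edge probabilities are conditional expectations, hence determined by `m`. -/
lemma aestronglyMeasurable (h : HasCondIndepEdges m P Gr w) {i j : Fin n} (hij : i < j) :
    AEStronglyMeasurable[m] (fun ω => w ω i j) P := by
  classical
  refine ⟨fun ω => ∑ g : SimpleGraph (Fin n) with g.Adj i j,
    (P[{ω | Gr ω = g}.indicator (fun _ => (1 : ℝ)) | m]) ω, ?_, ?_⟩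
  · exact Finset.stronglyMeasurable_fun_sum _ fun g _ => stronglyMeasurable_condExp
  · have h1 : ∀ᵐ ω ∂P, ∀ g : SimpleGraph (Fin n),
        (P[{ω | Gr ω = g}.indicator (fun _ => (1 : ℝ)) | m]) ω =
          ∏ e ∈ edgePairs n, (if g.Adj e.1 e.2 then w ω e.1 e.2 else 1 - w ω e.1 e.2) :=
      ae_all_iff.2 fun g => h.law g
    filter_upwards [h1] with ω hω
    simp only [hω]
    -- giving the absent edge `ij` the weight `0` restricts the sum to the graphs with edge `ij`
    have h2 := sum_graph_prod n (fun e => w ω e.1 e.2)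
      (fun e => if e = (i, j) then 0 else 1 - w ω e.1 e.2)
    have hmem : (i, j) ∈ edgePairs n := by simpa using hij
    rw [Finset.prod_eq_single (i, j) (by intro e _ he; simp [he]) (fun h => absurd hmem h)] at h2
    simp only [if_true, add_zero] at h2
    rw [← h2, Finset.sum_filter]
    refine Finset.sum_congr rfl fun g _ => ?_
    split_ifs with hg
    · refine Finset.prod_congr rfl fun e _ => ?_
      by_cases he : e = (i, j)
      · subst he; simp [hg]
      · simp [he]
    · refine Finset.prod_eq_zero hmem ?_
      rw [if_neg hg, if_pos rfl]

lemma aestronglyMeasurable_exp (h : HasCondIndepEdges m P Gr w) (c : Fin n × Fin n → ℝ)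
    (g : SimpleGraph (Fin n)) :
    AEStronglyMeasurable[m]
      (fun ω => Real.exp (∑ e ∈ edgePairs n, c e * edgeDev g (w ω) e.1 e.2)) P := by
  refine Real.continuous_exp.comp_aestronglyMeasurable ?_
  have hterm : ∀ e ∈ edgePairs n,
      AEStronglyMeasurable[m] (fun ω => c e * edgeDev g (w ω) e.1 e.2) P := fun e he =>
    (continuous_const.mul (continuous_const.sub continuous_id)).comp_aestronglyMeasurable
      (h.aestronglyMeasurable (Finset.mem_filter.1 he).2)
  generalize edgePairs n = s at hterm
  induction s using Finset.induction_on with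
  | empty => simpa using aestronglyMeasurable_const
  | insert e s hes ih =>
    simp only [Finset.sum_insert hes]
    exact (hterm e (Finset.mem_insert_self _ _)).add
      (ih fun e' he' => hterm e' (Finset.mem_insert_of_mem he'))

lemma exp_le (h : HasCondIndepEdges m P Gr w) (c : Fin n × Fin n → ℝ)
    (g : SimpleGraph (Fin n)) (ω : Ω) :
    ‖Real.exp (∑ e ∈ edgePairs n, c e * edgeDev g (w ω) e.1 e.2)‖ ≤
      Real.exp (∑ e ∈ edgePairs n, |c e|) := by
  rw [Real.norm_eq_abs, Real.abs_exp, Real.exp_le_exp]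
  refine Finset.sum_le_sum fun e _ => (le_abs_self _).trans ?_
  rw [abs_mul]
  exact mul_le_of_le_one_right (abs_nonneg _) (abs_edgeDev_le _ (h.mem_Icc ω) _ _)

lemma integrable_indicator_mul_exp [IsProbabilityMeasure P] (h : HasCondIndepEdges m P Gr w)
    (c : Fin n × Fin n → ℝ) (g : SimpleGraph (Fin n)) :
    Integrable (fun ω => {ω | Gr ω = g}.indicator (fun _ => (1 : ℝ)) ω *
        Real.exp (∑ e ∈ edgePairs n, c e * edgeDev g (w ω) e.1 e.2)) P := by
  refine Integrable.mul_bdd (c := Real.exp (∑ e ∈ edgePairs n, |c e|))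
    ((integrable_const 1).indicator (h.measurableSet_eq g))
    ((h.aestronglyMeasurable_exp c g).mono h.le) (ae_of_all _ (h.exp_le c g))

lemma integrable_exp [IsProbabilityMeasure P] (h : HasCondIndepEdges m P Gr w)
    (c : Fin n × Fin n → ℝ) :
    Integrable (fun ω => Real.exp (∑ e ∈ edgePairs n, c e * edgeDev (Gr ω) (w ω) e.1 e.2)) P := by
  classical
  simp only [exp_sum_edgeDev_eq_sum Gr w]
  exact integrable_finsetSum _ fun g _ => h.integrable_indicator_mul_exp c g

/-- The exponential moment of a linear statistic of the edges: conditionally on `m` it is a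
product of moment generating functions of centred Bernoulli variables. -/
lemma integral_exp_le [IsProbabilityMeasure P] (h : HasCondIndepEdges m P Gr w)
    {c : Fin n × Fin n → ℝ} (hc : ∀ e, |c e| ≤ 1) :
    ∫ ω, Real.exp (∑ e ∈ edgePairs n, c e * edgeDev (Gr ω) (w ω) e.1 e.2) ∂P ≤
      Real.exp (∑ e ∈ edgePairs n, c e ^ 2) := by
  classical
  have hint : ∀ g : SimpleGraph (Fin n), Integrable
      (fun ω => (∏ e ∈ edgePairs n, if g.Adj e.1 e.2 then w ω e.1 e.2 else 1 - w ω e.1 e.2) *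
        Real.exp (∑ e ∈ edgePairs n, c e * edgeDev g (w ω) e.1 e.2)) P ∧
      ∫ ω, {ω | Gr ω = g}.indicator (fun _ => (1 : ℝ)) ω *
        Real.exp (∑ e ∈ edgePairs n, c e * edgeDev g (w ω) e.1 e.2) ∂P =
      ∫ ω, (∏ e ∈ edgePairs n, if g.Adj e.1 e.2 then w ω e.1 e.2 else 1 - w ω e.1 e.2) *
        Real.exp (∑ e ∈ edgePairs n, c e * edgeDev g (w ω) e.1 e.2) ∂P := by
    intro g
    have h1 := condExp_mul_of_aestronglyMeasurable_right (h.aestronglyMeasurable_exp c g)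
      (h.integrable_indicator_mul_exp c g)
      ((integrable_const (1 : ℝ)).indicator (h.measurableSet_eq g))
    have h2 : P[fun ω => {ω | Gr ω = g}.indicator (fun _ => (1 : ℝ)) ω *
        Real.exp (∑ e ∈ edgePairs n, c e * edgeDev g (w ω) e.1 e.2) | m] =ᵐ[P]
        fun ω => (∏ e ∈ edgePairs n, if g.Adj e.1 e.2 then w ω e.1 e.2 else 1 - w ω e.1 e.2) *
        Real.exp (∑ e ∈ edgePairs n, c e * edgeDev g (w ω) e.1 e.2) := by
      refine h1.trans ?_
      filter_upwards [h.law g] with ω hω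
      rw [Pi.mul_apply, hω]
    refine ⟨integrable_condExp.congr h2, ?_⟩
    rw [← integral_congr_ae h2, integral_condExp h.le]
  simp only [exp_sum_edgeDev_eq_sum Gr w]
  rw [integral_finsetSum _ fun g _ => h.integrable_indicator_mul_exp c g,
    Finset.sum_congr rfl fun g _ => (hint g).2, ← integral_finsetSum _ fun g _ => (hint g).1]
  have hprod : ∀ ω, ∑ g : SimpleGraph (Fin n),
      (∏ e ∈ edgePairs n, if g.Adj e.1 e.2 then w ω e.1 e.2 else 1 - w ω e.1 e.2) *
        Real.exp (∑ e ∈ edgePairs n, c e * edgeDev g (w ω) e.1 e.2) =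
      ∏ e ∈ edgePairs n, (w ω e.1 e.2 * Real.exp (c e * (1 - w ω e.1 e.2)) +
        (1 - w ω e.1 e.2) * Real.exp (c e * (0 - w ω e.1 e.2))) := by
    intro ω
    rw [← sum_graph_prod]
    refine Finset.sum_congr rfl fun g _ => ?_
    rw [Real.exp_sum, ← Finset.prod_mul_distrib]
    refine Finset.prod_congr rfl fun e _ => ?_
    unfold edgeDev
    split_ifs <;> rfl
  simp only [hprod]
  refine (integral_mono_of_nonneg (g := fun _ => Real.exp (∑ e ∈ edgePairs n, c e ^ 2))
    (ae_of_all _ fun ω => ?_) (integrable_const _) (ae_of_all _ fun ω => ?_)).trans (by simp)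
  · refine Finset.prod_nonneg fun e _ => ?_
    have := h.mem_Icc ω e.1 e.2
    exact add_nonneg (mul_nonneg this.1 (Real.exp_pos _).le)
      (mul_nonneg (sub_nonneg.2 this.2) (Real.exp_pos _).le)
  · change _ ≤ Real.exp _
    rw [Real.exp_sum]
    refine Finset.prod_le_prod (fun e _ => ?_) fun e _ => bernoulli_mgf_le (h.mem_Icc _ _ _) (hc e)
    have := h.mem_Icc ω e.1 e.2
    exact add_nonneg (mul_nonneg this.1 (Real.exp_pos _).le)
      (mul_nonneg (sub_nonneg.2 this.2) (Real.exp_pos _).le)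

/-- The Chernoff bound for a linear statistic of the edges. -/
lemma measure_ge_le [IsProbabilityMeasure P] (h : HasCondIndepEdges m P Gr w)
    {c : Fin n × Fin n → ℝ} (hc : ∀ e, |c e| ≤ 1) (x : ℝ) :
    P {ω | x ≤ ∑ e ∈ edgePairs n, c e * edgeDev (Gr ω) (w ω) e.1 e.2} ≤
      ENNReal.ofReal (Real.exp (-x + ∑ e ∈ edgePairs n, c e ^ 2)) := by
  have h1 := ProbabilityTheory.measure_ge_le_exp_mul_mgf (μ := P) (t := 1)
    (X := fun ω => ∑ e ∈ edgePairs n, c e * edgeDev (Gr ω) (w ω) e.1 e.2) x zero_le_one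
    (by simpa using h.integrable_exp c)
  rw [← ofReal_measureReal]
  refine ENNReal.ofReal_le_ofReal (h1.trans ?_)
  rw [Real.exp_add]
  simp only [neg_mul, one_mul, ProbabilityTheory.mgf]
  exact mul_le_mul_of_nonneg_left (h.integral_exp_le hc) (Real.exp_pos _).le

end HasCondIndepEdges

/-! ### Sign patterns -/

/-- The sign `±1` as a real number. -/
abbrev sgn (u : ℤˣ) : ℝ := ((u : ℤ) : ℝ)

lemma abs_sgn (u : ℤˣ) : |sgn u| = 1 := by
  rcases Int.units_eq_one_or u with rfl | rfl <;> simp [sgn]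

lemma exists_sgn_mul_eq_abs (x : ℝ) : ∃ u : ℤˣ, sgn u * x = |x| := by
  rcases le_total 0 x with h | h
  · exact ⟨1, by simp [sgn, abs_of_nonneg h]⟩
  · exact ⟨-1, by simp [sgn, abs_of_nonpos h]⟩

lemma sum_mul_le_of_abs_le {ι : Type*} [Fintype ι] {α v : ι → ℝ} {δ : ℝ}
    (hα : ∀ i, |α i| ≤ δ) : |∑ i, α i * v i| ≤ δ * ∑ i, |v i| := by
  rw [Finset.mul_sum]
  refine (Finset.abs_sum_le_sum_abs _ _).trans (Finset.sum_le_sum fun i _ => ?_)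
  rw [abs_mul]
  exact mul_le_mul_of_nonneg_right (hα i) (abs_nonneg _)

/-- A bilinear form on a cube is bounded by its values at sign vectors. -/
lemma abs_bilin_le_of_sgn {ι : Type*} [Fintype ι] {M : ι → ι → ℝ} {B δ : ℝ} (hδ : 0 ≤ δ)
    (hB : ∀ s r : ι → ℤˣ, ∑ i, ∑ j, sgn (s i) * sgn (r j) * M i j ≤ B)
    {α β : ι → ℝ} (hα : ∀ i, |α i| ≤ δ) (hβ : ∀ i, |β i| ≤ δ) :
    |∑ i, ∑ j, α i * β j * M i j| ≤ δ ^ 2 * B := by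
  -- the signs `s` and `r` turn the absolute row and column sums into sign patterns
  choose s hs using fun i => exists_sgn_mul_eq_abs (∑ j, β j * M i j)
  choose r hr using fun j => exists_sgn_mul_eq_abs (∑ i, sgn (s i) * M i j)
  have e1 : ∑ i, ∑ j, α i * β j * M i j = ∑ i, α i * ∑ j, β j * M i j := by
    simp only [Finset.mul_sum, mul_assoc]
  have e2 : ∑ i, |∑ j, β j * M i j| = ∑ j, β j * ∑ i, sgn (s i) * M i j := by
    simp only [← hs, Finset.mul_sum]
    rw [Finset.sum_comm]
    exact Finset.sum_congr rfl fun _ _ => Finset.sum_congr rfl fun _ _ => by ring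
  have e3 : ∑ j, |∑ i, sgn (s i) * M i j| = ∑ i, ∑ j, sgn (s i) * sgn (r j) * M i j := by
    simp only [← hr, Finset.mul_sum]
    rw [Finset.sum_comm]
    exact Finset.sum_congr rfl fun _ _ => Finset.sum_congr rfl fun _ _ => by ring
  calc |∑ i, ∑ j, α i * β j * M i j| ≤ δ * ∑ i, |∑ j, β j * M i j| := by
        rw [e1]; exact sum_mul_le_of_abs_le hα
    _ ≤ δ * (δ * ∑ j, |∑ i, sgn (s i) * M i j|) := by
        refine mul_le_mul_of_nonneg_left ?_ hδ
        rw [e2]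
        exact (le_abs_self _).trans (sum_mul_le_of_abs_le hβ)
    _ ≤ δ ^ 2 * B := by
        rw [← mul_assoc, ← sq, e3]
        exact mul_le_mul_of_nonneg_left (hB s r) (sq_nonneg δ)

lemma sum_sum_eq_edgePairs {n : ℕ} (f : Fin n → Fin n → ℝ) :
    ∑ i, ∑ j, f i j = ∑ e ∈ edgePairs n, (f e.1 e.2 + f e.2 e.1) + ∑ i, f i i := by
  rw [← Fintype.sum_prod_type', Finset.sum_add_distrib]
  rw [← Finset.sum_filter_add_sum_filter_not Finset.univ (fun e : Fin n × Fin n => e.1 < e.2),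
    add_assoc]
  congr 1
  rw [← Finset.sum_filter_add_sum_filter_not
    (Finset.univ.filter fun e : Fin n × Fin n => ¬ e.1 < e.2) (fun e : Fin n × Fin n => e.2 < e.1)]
  congr 1
  · refine Finset.sum_nbij' Prod.swap Prod.swap ?_ ?_ ?_ ?_ ?_ <;> simp +contextual [le_of_lt]
  · refine Finset.sum_nbij' Prod.fst (fun i => (i, i)) ?_ ?_ ?_ ?_ ?_
    · simp
    · simp
    · simp +contextual [le_antisymm_iff]
    · simp
    · rintro ⟨a, b⟩ h
      simp only [Finset.mem_filter, Finset.mem_univ, true_and, not_lt] at h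
      rw [le_antisymm h.2 h.1]

/-! ### Exponential concentration in cut norm -/

section Concentration

variable {Ω : Type*} {m : MeasurableSpace Ω} [m0 : MeasurableSpace Ω] {P : Measure Ω}
  {n : ℕ} {Gr : Ω → SimpleGraph (Fin n)} {w : Ω → Fin n → Fin n → ℝ}

/-- Chernoff bound for one sign pattern. -/
lemma HasCondIndepEdges.measure_sgn_ge_le [IsProbabilityMeasure P]
    (h : HasCondIndepEdges m P Gr w) {ε : ℝ} (hε : 0 < ε) (hε1 : ε ≤ 1) (hn : 2 / ε ≤ n)
    (s r : Fin n → ℤˣ) :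
    P {ω | ε * n ^ 2 ≤ ∑ i, ∑ j, sgn (s i) * sgn (r j) * edgeDev (Gr ω) (w ω) i j} ≤
      ENNReal.ofReal (Real.exp (-(ε ^ 2 / 64 * n ^ 2))) := by
  -- the factor `ε / 16` balances the linear and the quadratic term of the Chernoff bound
  set c : Fin n × Fin n → ℝ := fun e =>
    ε / 16 * (sgn (s e.1) * sgn (r e.2) + sgn (s e.2) * sgn (r e.1)) with hc
  have hc2 : ∀ e, |c e| ≤ ε / 8 := by
    intro e
    rw [hc, abs_mul, abs_of_pos (by positivity)]
    have : |sgn (s e.1) * sgn (r e.2) + sgn (s e.2) * sgn (r e.1)| ≤ 2 := by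
      refine (abs_add_le _ _).trans ?_
      rw [abs_mul, abs_mul, abs_sgn, abs_sgn, abs_sgn, abs_sgn]
      norm_num
    nlinarith
  have hcard : ((edgePairs n).card : ℝ) ≤ n ^ 2 := by
    have := Finset.card_filter_le (Finset.univ : Finset (Fin n × Fin n)) (fun e => e.1 < e.2)
    simp only [Finset.card_univ, Fintype.card_prod, Fintype.card_fin] at this
    rw [sq]; exact_mod_cast this
  have hsq : ∑ e ∈ edgePairs n, c e ^ 2 ≤ ε ^ 2 / 64 * n ^ 2 := by
    have : ∑ e ∈ edgePairs n, c e ^ 2 ≤ ∑ e ∈ edgePairs n, ε ^ 2 / 64 := by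
      refine Finset.sum_le_sum fun e _ => ?_
      rw [← sq_abs]
      have := pow_le_pow_left₀ (abs_nonneg _) (hc2 e) 2
      linarith [this, show (ε / 8) ^ 2 = ε ^ 2 / 64 by ring]
    refine this.trans ?_
    rw [Finset.sum_const, nsmul_eq_mul, mul_comm]
    exact mul_le_mul_of_nonneg_left hcard (by positivity)
  -- the diagonal contributes at most `n`, hence at most half of `ε n ^ 2`
  have hsub : {ω | ε * n ^ 2 ≤ ∑ i, ∑ j, sgn (s i) * sgn (r j) * edgeDev (Gr ω) (w ω) i j} ⊆
      {ω | ε ^ 2 / 32 * n ^ 2 ≤ ∑ e ∈ edgePairs n, c e * edgeDev (Gr ω) (w ω) e.1 e.2} := by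
    intro ω hω
    simp only [mem_ofPred_eq] at hω ⊢
    rw [sum_sum_eq_edgePairs] at hω
    have hd : ∑ i, sgn (s i) * sgn (r i) * edgeDev (Gr ω) (w ω) i i ≤ n := by
      have : ∑ i, sgn (s i) * sgn (r i) * edgeDev (Gr ω) (w ω) i i ≤ ∑ i : Fin n, (1 : ℝ) := by
        refine Finset.sum_le_sum fun i _ => (le_abs_self _).trans ?_
        rw [abs_mul, abs_mul, abs_sgn, abs_sgn, one_mul, one_mul]
        exact abs_edgeDev_le _ (h.mem_Icc ω) _ _
      simpa using this
    have e1 : ∑ e ∈ edgePairs n, c e * edgeDev (Gr ω) (w ω) e.1 e.2 =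
        ε / 16 * ∑ e ∈ edgePairs n, (sgn (s e.1) * sgn (r e.2) * edgeDev (Gr ω) (w ω) e.1 e.2 +
          sgn (s e.2) * sgn (r e.1) * edgeDev (Gr ω) (w ω) e.2 e.1) := by
      rw [Finset.mul_sum]
      refine Finset.sum_congr rfl fun e _ => ?_
      rw [edgeDev_comm (Gr ω) (h.symm ω) e.2 e.1, hc]
      ring
    rw [e1]
    rw [div_le_iff₀ hε] at hn
    have hn0 : (0 : ℝ) ≤ n := Nat.cast_nonneg n
    have h3 : ε * n ^ 2 / 2 ≤ ∑ e ∈ edgePairs n,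
        (sgn (s e.1) * sgn (r e.2) * edgeDev (Gr ω) (w ω) e.1 e.2 +
          sgn (s e.2) * sgn (r e.1) * edgeDev (Gr ω) (w ω) e.2 e.1) := by
      nlinarith
    nlinarith [mul_le_mul_of_nonneg_left h3 (show 0 ≤ ε / 16 by positivity)]
  refine (measure_mono hsub).trans ((h.measure_ge_le (fun e => (hc2 e).trans (by linarith)) _).trans
    (ENNReal.ofReal_le_ofReal (Real.exp_le_exp.2 ?_)))
  linarith

/-- Union bound over the `4 ^ n` sign patterns. -/
lemma HasCondIndepEdges.measure_exists_sgn_ge_le [IsProbabilityMeasure P]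
    (h : HasCondIndepEdges m P Gr w) {ε : ℝ} (hε : 0 < ε) (hε1 : ε ≤ 1) (hn : 2 / ε ≤ n) :
    P {ω | ∃ s r : Fin n → ℤˣ,
      ε * n ^ 2 ≤ ∑ i, ∑ j, sgn (s i) * sgn (r j) * edgeDev (Gr ω) (w ω) i j} ≤
      ENNReal.ofReal (Real.exp (n * Real.log 4 - ε ^ 2 / 64 * n ^ 2)) := by
  have h1 : {ω | ∃ s r : Fin n → ℤˣ,
      ε * n ^ 2 ≤ ∑ i, ∑ j, sgn (s i) * sgn (r j) * edgeDev (Gr ω) (w ω) i j} =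
      ⋃ p : (Fin n → ℤˣ) × (Fin n → ℤˣ),
      {ω | ε * n ^ 2 ≤ ∑ i, ∑ j, sgn (p.1 i) * sgn (p.2 j) * edgeDev (Gr ω) (w ω) i j} := by
    ext ω; simp
  rw [h1]
  refine (measure_iUnion_fintype_le _ _).trans
    ((Finset.sum_le_sum fun p _ => h.measure_sgn_ge_le hε hε1 hn p.1 p.2).trans ?_)
  rw [Finset.sum_const, nsmul_eq_mul, Finset.card_univ, Fintype.card_prod, Fintype.card_fun,
    Fintype.card_fin, Fintype.card_units_int, ← ENNReal.ofReal_natCast,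
    ← ENNReal.ofReal_mul (Nat.cast_nonneg _)]
  refine ENNReal.ofReal_le_ofReal (le_of_eq ?_)
  rw [sub_eq_add_neg, Real.exp_add, mul_comm (n : ℝ), Real.exp_mul, Real.exp_log (by norm_num)]
  rw [Real.rpow_natCast]
  push_cast
  rw [← mul_pow]
  norm_num

end Concentration

/-! ### The partition of the unit interval into cells -/

/-- The cell `(k/n, (k+1)/n]` of the unit interval, which carries the vertex `k : Fin n` in the
empirical graphon. -/
def cell (n : ℕ) (k : Fin n) : Set unitInterval := {x | ⌈(n : ℝ) * x⌉₊ = k + 1}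

lemma mem_cell_iff {n : ℕ} {k : Fin n} {x : unitInterval} :
    x ∈ cell n k ↔ (k : ℝ) < n * x ∧ n * (x : ℝ) ≤ k + 1 := by
  unfold cell
  rw [mem_ofPred_eq, Nat.ceil_eq_iff (Nat.succ_ne_zero _)]
  simp

lemma measurableSet_cell (n : ℕ) (k : Fin n) : MeasurableSet (cell n k) :=
  (measurableSet_singleton ((k : ℕ) + 1)).preimage
    (Nat.measurable_ceil.comp (measurable_const.mul measurable_subtype_coe))

lemma eq_of_mem_cell {n : ℕ} {k l : Fin n} {x : unitInterval} (hk : x ∈ cell n k)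
    (hl : x ∈ cell n l) : k = l := by
  have h : (k : ℕ) + 1 = l + 1 := hk.symm.trans hl
  exact Fin.ext (by omega)

/-- The cells cover `(0,1]`. -/
lemma exists_mem_cell {n : ℕ} (hn : 0 < n) {x : unitInterval} (hx : x ≠ 0) :
    ∃ k, x ∈ cell n k := by
  have hx0 : (0 : ℝ) < x := unitInterval.pos_iff_ne_zero.2 hx
  have hpos : 0 < ⌈(n : ℝ) * x⌉₊ := Nat.ceil_pos.2 (by positivity)
  have hle : ⌈(n : ℝ) * x⌉₊ ≤ n := Nat.ceil_le.2 (mul_le_of_le_one_right (by positivity) x.2.2)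
  exact ⟨⟨⌈(n : ℝ) * x⌉₊ - 1, by omega⟩, by change _ = _ - 1 + 1; omega⟩

lemma notMem_cell_zero (n : ℕ) (k : Fin n) : (0 : unitInterval) ∉ cell n k := by
  rw [mem_cell_iff]; rintro ⟨h, -⟩
  simp at h
  exact absurd h (not_lt.2 (Nat.cast_nonneg _))

lemma volume_cell_le (n : ℕ) (k : Fin n) :
    (volume : Measure unitInterval).real (cell n k) ≤ 1 / n := by
  have hn : (0 : ℝ) < n := by exact_mod_cast k.pos
  have hk : ((k : ℕ) : ℝ) + 1 ≤ n := by exact_mod_cast k.2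
  have h0 : (k : ℝ) / n ∈ Icc (0 : ℝ) 1 := ⟨by positivity, by rw [div_le_one hn]; linarith⟩
  have h1 : ((k : ℝ) + 1) / n ∈ Icc (0 : ℝ) 1 := ⟨by positivity, by rw [div_le_one hn]; linarith⟩
  have hsub : cell n k ⊆ Ioc (⟨_, h0⟩ : unitInterval) ⟨_, h1⟩ := by
    intro x hx
    rw [mem_cell_iff] at hx
    refine ⟨?_, ?_⟩
    · change (k : ℝ) / n < x
      rw [div_lt_iff₀ hn]; linarith
    · change (x : ℝ) ≤ _
      rw [le_div_iff₀ hn]; linarith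
  refine (measureReal_mono hsub).trans (le_of_eq ?_)
  rw [Measure.real, unitInterval.volume_Ioc, ENNReal.toReal_ofReal]
  · simp only; ring
  · simp only; rw [← sub_div]; simp

/-! ### Rearranging the cells -/

/-- The piecewise translation that moves the cell `k` onto the cell `σ k`. The point `0`, which
lies in no cell, is fixed; the projection onto the unit interval is never active. -/
noncomputable def cellShift {n : ℕ} (σ : Equiv.Perm (Fin n)) (x : unitInterval) : unitInterval :=
  projIcc 0 1 zero_le_one
    ((x : ℝ) + ∑ k, (cell n k).indicator (fun _ => ((σ k : ℝ) - k) / n) x)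

lemma measurable_cellShift {n : ℕ} (σ : Equiv.Perm (Fin n)) : Measurable (cellShift σ) := by
  refine continuous_projIcc.measurable.comp (measurable_subtype_coe.add ?_)
  exact Finset.measurable_sum _ fun k _ => measurable_const.indicator (measurableSet_cell n k)

lemma coe_cellShift {n : ℕ} (σ : Equiv.Perm (Fin n)) {k : Fin n} {x : unitInterval}
    (hx : x ∈ cell n k) : (cellShift σ x : ℝ) = x + ((σ k : ℝ) - k) / n := by
  have hn : (0 : ℝ) < n := by exact_mod_cast k.pos
  have hσ : ((σ k : ℕ) : ℝ) + 1 ≤ n := by exact_mod_cast (σ k).2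
  have h0 : (0 : ℝ) ≤ (σ k : ℕ) := Nat.cast_nonneg _
  have hsum : ∑ l, (cell n l).indicator (fun _ => ((σ l : ℝ) - l) / n) x = ((σ k : ℝ) - k) / n := by
    rw [Finset.sum_eq_single k, indicator_of_mem hx]
    · exact fun l _ hl => indicator_of_notMem (fun h => hl (eq_of_mem_cell h hx)) _
    · simp
  have he : (x : ℝ) + ((σ k : ℝ) - k) / n = (n * x + σ k - k) / n := by field_simp; ring
  rw [mem_cell_iff] at hx
  rw [cellShift, hsum, projIcc_of_mem]
  rw [he]
  exact ⟨div_nonneg (by linarith) hn.le, by rw [div_le_one hn]; linarith⟩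

lemma cellShift_mem {n : ℕ} (σ : Equiv.Perm (Fin n)) {k : Fin n} {x : unitInterval}
    (hx : x ∈ cell n k) : cellShift σ x ∈ cell n (σ k) := by
  have hn : (0 : ℝ) < n := by exact_mod_cast k.pos
  rw [mem_cell_iff, coe_cellShift σ hx, mul_add, mul_div_cancel₀ _ hn.ne']
  rw [mem_cell_iff] at hx
  constructor <;> linarith

lemma cellShift_zero {n : ℕ} (σ : Equiv.Perm (Fin n)) : cellShift σ 0 = 0 := by
  have : ∑ k, (cell n k).indicator (fun _ => ((σ k : ℝ) - k) / n) (0 : unitInterval) = 0 :=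
    Finset.sum_eq_zero fun k _ => indicator_of_notMem (notMem_cell_zero n k) _
  rw [cellShift, this]
  simp

lemma cellShift_symm_cellShift {n : ℕ} (hn : 0 < n) (σ : Equiv.Perm (Fin n)) (x : unitInterval) :
    cellShift σ.symm (cellShift σ x) = x := by
  by_cases hx : x = 0
  · rw [hx, cellShift_zero, cellShift_zero]
  · obtain ⟨k, hk⟩ := exists_mem_cell hn hx
    refine Subtype.ext ?_
    rw [coe_cellShift _ (cellShift_mem σ hk), coe_cellShift σ hk, Equiv.symm_apply_apply]
    ring

/-- On each cell the rearrangement is a translation, so it does not increase the measure of a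
preimage. -/
lemma volume_preimage_cellShift_le {n : ℕ} (hn : 0 < n) (σ : Equiv.Perm (Fin n))
    {A : Set unitInterval} (hA : MeasurableSet A) :
    volume (cellShift σ ⁻¹' A) ≤ volume A := by
  have hcell : ∀ k, volume (cell n k ∩ cellShift σ ⁻¹' A) ≤ volume (A ∩ cell n (σ k)) := by
    intro k
    rw [unitInterval.volume_apply, unitInterval.volume_apply,
      ← measure_preimage_add_right volume (((σ k : ℝ) - k) / n)
        (Subtype.val '' (A ∩ cell n (σ k)))]
    refine measure_mono ?_
    rintro _ ⟨x, ⟨hx, hxA⟩, rfl⟩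
    exact ⟨cellShift σ x, ⟨hxA, cellShift_mem σ hx⟩, coe_cellShift σ hx⟩
  have hsub : cellShift σ ⁻¹' A ⊆ {0} ∪ ⋃ k, (cell n k ∩ cellShift σ ⁻¹' A) := by
    intro x hx
    by_cases hx0 : x = 0
    · exact Or.inl hx0
    · obtain ⟨k, hk⟩ := exists_mem_cell hn hx0
      exact Or.inr (mem_iUnion.2 ⟨k, hk, hx⟩)
  calc volume (cellShift σ ⁻¹' A) ≤ volume ({0} : Set unitInterval) +
        ∑ k, volume (cell n k ∩ cellShift σ ⁻¹' A) :=
        (measure_mono hsub).trans ((measure_union_le _ _).trans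
          (add_le_add le_rfl (measure_iUnion_fintype_le _ _)))
    _ ≤ ∑ k, volume (A ∩ cell n (σ k)) := by
        rw [measure_singleton, zero_add]
        exact Finset.sum_le_sum fun k _ => hcell k
    _ = ∑ k, volume (A ∩ cell n k) := Equiv.sum_comp σ fun k => volume (A ∩ cell n k)
    _ = volume (⋃ k, A ∩ cell n k) := by
        rw [measure_iUnion _ fun k => hA.inter (measurableSet_cell n k), tsum_fintype]
        intro k l hkl
        exact Set.disjoint_left.2 fun x hx hx' => hkl (eq_of_mem_cell hx.2 hx'.2)
    _ ≤ volume A := measure_mono (iUnion_subset fun k => inter_subset_left)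

/-- The rearrangement of the cells as a measure-preserving bijection. -/
noncomputable def cellPerm {n : ℕ} (hn : 0 < n) (σ : Equiv.Perm (Fin n)) : Kern.MPBij :=
  ⟨{ toFun := cellShift σ
     invFun := cellShift σ.symm
     left_inv := cellShift_symm_cellShift hn σ
     right_inv := cellShift_symm_cellShift hn σ.symm
     measurable_toFun := measurable_cellShift σ
     measurable_invFun := measurable_cellShift σ.symm },
    ⟨measurable_cellShift σ, by
      change Measure.map (cellShift σ) volume = volume
      ext A hA
      rw [Measure.map_apply (measurable_cellShift σ) hA]
      refine le_antisymm (volume_preimage_cellShift_le hn σ hA) ?_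
      have h := volume_preimage_cellShift_le hn σ.symm (measurable_cellShift σ hA)
      rw [← preimage_comp] at h
      have hid : cellShift σ ∘ cellShift σ.symm = id :=
        funext (cellShift_symm_cellShift hn σ.symm)
      rwa [hid, preimage_id] at h⟩⟩

/-! ### The cut norm of a step kernel -/

/-- If the difference of two kernels is almost everywhere a step function on the cells, then its
cut norm is bounded by the sign patterns of its matrix. -/
lemma Kern.cutDist_le_of_step {f g : Kern} {n : ℕ} (hn : 0 < n) {M : Fin n → Fin n → ℝ} {B : ℝ}
    (hM : ∀ k l, ∀ᵐ p : unitInterval × unitInterval, p.1 ∈ cell n k → p.2 ∈ cell n l →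
      f.diff g p = M k l)
    (hB : ∀ s r : Fin n → ℤˣ, ∑ i, ∑ j, sgn (s i) * sgn (r j) * M i j ≤ B) :
    f.cutDist g ≤ (1 / n) ^ 2 * B := by
  have hne : ∀ᵐ p : unitInterval × unitInterval, p.1 ≠ 0 ∧ p.2 ≠ 0 := by
    have h0 : ∀ᵐ x : unitInterval, x ≠ 0 := by simp [ae_iff]
    exact (Measure.quasiMeasurePreserving_fst.ae h0).and
      (Measure.quasiMeasurePreserving_snd.ae h0)
  have hstep : ∀ᵐ p : unitInterval × unitInterval,
      f.diff g p = ∑ k, ∑ l, (cell n k ×ˢ cell n l).indicator (fun _ => M k l) p := by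
    filter_upwards [hne, ae_all_iff.2 fun k => ae_all_iff.2 (hM k)] with p hp hpM
    obtain ⟨k, hk⟩ := exists_mem_cell hn hp.1
    obtain ⟨l, hl⟩ := exists_mem_cell hn hp.2
    have hkl : p ∈ cell n k ×ˢ cell n l := ⟨hk, hl⟩
    rw [Finset.sum_eq_single k, Finset.sum_eq_single l, indicator_of_mem hkl, hpM k l hk hl]
    · exact fun j _ hj => indicator_of_notMem (fun h => hj (eq_of_mem_cell h.2 hl)) _
    · simp
    · exact fun i _ hi => Finset.sum_eq_zero fun j _ =>
        indicator_of_notMem (fun h => hi (eq_of_mem_cell h.1 hk)) _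
    · simp
  refine ciSup_le fun AB => ?_
  obtain ⟨⟨A, hA⟩, ⟨C, hC⟩⟩ := AB
  have hms : ∀ k l, MeasurableSet (cell n k ×ˢ cell n l) := fun k l =>
    (measurableSet_cell n k).prod (measurableSet_cell n l)
  have hint : ∀ k l, Integrable ((cell n k ×ˢ cell n l).indicator fun _ => M k l)
      (volume.restrict (A ×ˢ C)) := fun k l =>
    (integrable_const _).indicator (hms k l)
  have e : ∫ p in A ×ˢ C, f.diff g p =
      ∑ k, ∑ l, volume.real (cell n k ∩ A) * volume.real (cell n l ∩ C) * M k l := by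
    rw [integral_congr_ae (ae_restrict_of_ae hstep),
      integral_finsetSum _ fun k _ => integrable_finsetSum _ fun l _ => hint k l]
    refine Finset.sum_congr rfl fun k _ => ?_
    rw [integral_finsetSum _ fun l _ => hint k l]
    refine Finset.sum_congr rfl fun l _ => ?_
    rw [integral_indicator_const _ (hms k l), measureReal_restrict_apply (hms k l), prod_inter_prod,
      smul_eq_mul]
    congr 1
    exact measureReal_prod_prod _ _
  change |∫ p in A ×ˢ C, f.diff g p| ≤ _
  rw [e]
  have habs : ∀ (k : Fin n) (D : Set unitInterval),
      |(volume : Measure unitInterval).real (cell n k ∩ D)| ≤ 1 / n := fun k D => by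
    rw [abs_of_nonneg measureReal_nonneg]
    exact (measureReal_mono inter_subset_left).trans (volume_cell_le n k)
  exact abs_bilin_le_of_sgn (by positivity) hB (fun k => habs k A) fun l => habs l C

/-! ### Quantiles of an empirical distribution -/

lemma TypeDist.cdf_empDist {n : ℕ+} (x : Fin n → unitInterval) (y : unitInterval) :
    (empDist x).cdf y = (Finset.univ.filter fun i => x i ≤ y).card / (n : ℝ) := by
  change (((n : ℕ) : ℝ≥0∞)⁻¹ • ∑ i, Measure.dirac (x i) : Measure unitInterval).real (Iic y) = _
  rw [measureReal_ennreal_smul_apply, measureReal_def, Measure.finsetSum_apply]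
  rw [ENNReal.toReal_inv, ENNReal.toReal_natCast, div_eq_inv_mul]
  congr 1
  rw [ENNReal.toReal_sum fun _ _ => measure_ne_top _ _]
  simp [Measure.dirac_apply' _ measurableSet_Iic, indicator_apply, Finset.sum_boole,
    apply_ite ENNReal.toReal]

/-- Inside the cell `k` the generalised inverse of an empirical distribution function takes the
value of the order statistic with index `k`. -/
lemma TypeDist.inv_empDist {n : ℕ+} (x : Fin n → unitInterval) {k : Fin n} {u : unitInterval}
    (hu : u ∈ cell n k) (hu' : (n : ℝ) * u ≠ k + 1) :
    (empDist x).inv u = x (Tuple.sort x k) := by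
  have hn : (0 : ℝ) < (n : ℕ) := by exact_mod_cast n.pos
  rw [mem_cell_iff] at hu
  have hlt : (n : ℝ) * u < k + 1 := lt_of_le_of_ne hu.2 hu'
  set σ := Tuple.sort x
  have hmono : Monotone (x ∘ σ) := Tuple.monotone_sort x
  have hcard : ∀ y, (Finset.univ.filter fun i => x i ≤ y).card =
      (Finset.univ.filter fun i => x (σ i) ≤ y).card := by
    intro y
    refine Finset.card_bij' (fun i _ => σ.symm i) (fun i _ => σ i) ?_ ?_ ?_ ?_ <;> simp
  have hcdf : ∀ y, (u : ℝ) < (empDist x).cdf y ↔ x (σ k) ≤ y := by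
    intro y
    rw [cdf_empDist, hcard, lt_div_iff₀ hn, mul_comm]
    constructor
    · intro h
      by_contra hy
      have hsub : (Finset.univ.filter fun i => x (σ i) ≤ y) ⊆ Finset.Iio k := by
        intro i hi
        rw [Finset.mem_Iio]
        by_contra hki
        exact hy ((hmono (not_lt.1 hki)).trans (Finset.mem_filter.1 hi).2)
      have := Finset.card_le_card hsub
      rw [Fin.card_Iio] at this
      have h2 : ((Finset.univ.filter fun i => x (σ i) ≤ y).card : ℝ) ≤ k := by exact_mod_cast this
      linarith [hu.1]
    · intro hy
      have hsub : Finset.Iic k ⊆ (Finset.univ.filter fun i => x (σ i) ≤ y) := by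
        intro i hi
        exact Finset.mem_filter.2 ⟨Finset.mem_univ _, (hmono (Finset.mem_Iic.1 hi)).trans hy⟩
      have := Finset.card_le_card hsub
      rw [Fin.card_Iic] at this
      have h2 : (k : ℝ) + 1 ≤ ((Finset.univ.filter fun i => x (σ i) ≤ y).card : ℝ) := by
        exact_mod_cast this
      linarith
  have hset : (empDist x).invSet u = Icc (x (σ k) : ℝ) 1 := by
    ext y
    constructor
    · rintro (rfl | ⟨hy, h⟩)
      · exact ⟨(x (σ k)).2.2, le_rfl⟩
      · exact ⟨(hcdf _).1 h, hy.2⟩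
    · intro hy
      exact Or.inr ⟨⟨(x (σ k)).2.1.trans hy.1, hy.2⟩, (hcdf _).2 hy.1⟩
  refine Subtype.ext ?_
  change sInf ((empDist x).invSet u) = _
  rw [hset, csInf_Icc (x (σ k)).2.2]

/-! ### The empirical graphon and the reference graphon -/

lemma empGraphon_apply {n : ℕ} (g : SimpleGraph (Fin n)) {k l : Fin n} {x y : unitInterval}
    (hx : x ∈ cell n k) (hy : y ∈ cell n l) :
    ((empGraphon g).toFun x y : ℝ) = open scoped Classical in if g.Adj k l then 1 else 0 := by
  have h : (∃ i j : Fin n, ⌈(n : ℝ) * x⌉₊ = i + 1 ∧ ⌈(n : ℝ) * y⌉₊ = j + 1 ∧ g.Adj i j) ↔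
      g.Adj k l := by
    constructor
    · rintro ⟨i, j, hi, hj, hij⟩
      rwa [eq_of_mem_cell hx hi, eq_of_mem_cell hy hj]
    · exact fun h => ⟨k, l, hx, hy, h⟩
  by_cases hkl : g.Adj k l
  · simp only [empGraphon, if_pos (h.2 hkl), if_pos hkl, Set.Icc.coe_one]
  · simp only [empGraphon, if_neg (mt h.1 hkl), if_neg hkl, Set.Icc.coe_zero]

/-- After moving the vertices into the increasing order of their types, the empirical graphon and
the reference graphon are step kernels on the same cells. -/
lemma cutMetric_empGraphon_le {T : ℝ} (H : ConnFun T) (F : TypePath T) (t : Icc (0 : ℝ) T)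
    {n : ℕ+} (x : Fin n → unitInterval) (hF : F.toFun t = empDist x) (g : SimpleGraph (Fin n))
    {B : ℝ} (hB : ∀ s r : Fin n → ℤˣ, ∑ i, ∑ j, sgn (s i) * sgn (r j) *
      edgeDev g (fun i j => (H.toFun t (x i) (x j) F : ℝ)) i j ≤ B) :
    Kern.cutMetric (empGraphon g) (H.refGraphon F t) ≤ (1 / (n : ℕ)) ^ 2 * B := by
  set σ := Tuple.sort x
  set w : Fin n → Fin n → ℝ := fun i j => (H.toFun t (x i) (x j) F : ℝ)
  let ι : Kern.MPBij := ⟨MeasurableEquiv.refl _, MeasurePreserving.id _⟩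
  refine (ciInf_le (Kern.bddBelow_cut _ _) (cellPerm n.pos σ, ι)).trans ?_
  refine Kern.cutDist_le_of_step n.pos (M := fun k l => edgeDev g w (σ k) (σ l)) ?_ ?_
  · intro k l
    -- the right end points of the cells, where the generalised inverse may jump, are negligible
    have hgrid : ∀ i : Fin n, ∀ᵐ u : unitInterval, (n : ℝ) * u ≠ i + 1 := by
      intro i
      have hsub : {u : unitInterval | ¬ (n : ℝ) * u ≠ i + 1}.Subsingleton := by
        intro u hu v hv
        simp only [mem_ofPred_eq, not_not] at hu hv
        have hn : (n : ℝ) ≠ 0 := by exact_mod_cast n.ne_zero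
        exact Subtype.ext (mul_left_cancel₀ hn (hu.trans hv.symm))
      exact hsub.measure_zero _
    filter_upwards [Measure.quasiMeasurePreserving_fst.ae (hgrid k),
      Measure.quasiMeasurePreserving_snd.ae (hgrid l)] with p h1 h2 hk hl
    have hrel : (((empGraphon g).relabel (cellPerm n.pos σ)).toFun p.1 p.2 : ℝ) =
        open scoped Classical in if g.Adj (σ k) (σ l) then 1 else 0 :=
      empGraphon_apply g (cellShift_mem σ hk) (cellShift_mem σ hl)
    have href : (((H.refGraphon F t).relabel ι).toFun p.1 p.2 : ℝ) = w (σ k) (σ l) := by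
      change (H.toFun t ((F.toFun t).inv p.1) ((F.toFun t).inv p.2) F : ℝ) = _
      rw [hF, TypeDist.inv_empDist x hk h1, TypeDist.inv_empDist x hl h2]
    rw [Kern.diff, hrel, href, edgeDev]
  -- a permutation of the vertices permutes the sign patterns
  · intro s r
    have h := hB (s ∘ σ.symm) (r ∘ σ.symm)
    rw [← Equiv.sum_comp σ] at h
    refine le_trans (le_of_eq (Finset.sum_congr rfl fun k _ => ?_)) h
    rw [← Equiv.sum_comp σ fun j => sgn ((s ∘ σ.symm) (σ k)) * sgn ((r ∘ σ.symm) j) *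
      edgeDev g w (σ k) j]
    simp

/-! ### Evaluation of reference graphon paths at a fixed time -/

namespace Kern

lemma cutDist_le_l1Dist (f g : Kern) : cutDist f g ≤ l1Dist f g := by
  refine ciSup_le fun AB => (abs_integral_le_integral_abs).trans ?_
  exact setIntegral_le_integral (f.integrable_diff g).abs (ae_of_all _ fun p => abs_nonneg _)

lemma cutMetric_le_l1Dist (f g : Kern) : cutMetric f g ≤ l1Dist f g := by
  let ι : MPBij := ⟨MeasurableEquiv.refl _, MeasurePreserving.id _⟩
  exact (ciInf_le (bddBelow_cut f g) (ι, ι)).trans (cutDist_le_l1Dist f g)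

lemma edist_tilde_le (f g : Kern) : edist f.tilde g.tilde ≤ edist f.toL1 g.toL1 := by
  rw [edist_dist, edist_dist]
  exact ENNReal.ofReal_le_ofReal (cutMetric_le_l1Dist f g)

end Kern

/-- Evaluation at a time at which the limiting path does not jump is continuous in the Skorokhod
topology. At the terminal time no assumption is needed, since every time change fixes it. -/
lemma ConnFun.InducesContinuousMap.continuousAt_tilde {T : ℝ} {H : ConnFun T}
    (hH : H.InducesContinuousMap) {F : TypePath T} {t : Icc (0 : ℝ) T}
    (ht : (t : ℝ) < T → ContinuousAt (fun s => (H.refGraphon F s).tilde) t) :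
    ContinuousAt (fun F' => (H.refGraphon F' t).tilde) F := by
  obtain ⟨Φ, hΦ, hΦH⟩ := hH
  refine EMetric.tendsto_nhds.2 fun ε hε => ?_
  have hε2 : 0 < ε / 2 := ENNReal.half_pos hε.ne'
  obtain ⟨δ, hδ, hδt⟩ : ∃ δ > 0, ∀ θ : Icc (0 : ℝ) T ≃o Icc (0 : ℝ) T, edist (θ t) t < δ →
      edist (H.refGraphon F (θ t)).tilde (H.refGraphon F t).tilde < ε / 2 := by
    rcases t.2.2.lt_or_eq with h | h
    · obtain ⟨δ, hδ, hδt⟩ := EMetric.tendsto_nhds_nhds.1 (ht h) (ε / 2) hε2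
      exact ⟨δ, hδ, fun θ hθ => hδt hθ⟩
    · refine ⟨1, one_pos, fun θ _ => ?_⟩
      have hmax : ∀ s, s ≤ t := fun s => Subtype.mk_le_mk.2 (s.2.2.trans h.ge)
      have hθ : θ t = t := le_antisymm (hmax _) (θ.symm_apply_le.1 (hmax _))
      rw [hθ, edist_self]
      exact hε2
  filter_upwards [EMetric.tendsto_nhds.1 (hΦ.tendsto F) (min δ (ε / 2)) (lt_min hδ hε2)] with F' hF'
  obtain ⟨θ, hθ⟩ := iInf_lt_iff.1 hF'
  have h1 : edist (θ t) t < δ :=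
    ((le_iSup (fun s => edist (θ s) s) t).trans (le_max_left _ _)).trans_lt
      (hθ.trans_le (min_le_left _ _))
  have h2 : edist ((Φ F').toFun t) ((Φ F).toFun (θ t)) < ε / 2 :=
    ((le_iSup (fun s => edist ((Φ F').toFun s) ((Φ F).toFun (θ s))) t).trans
      (le_max_right _ _)).trans_lt (hθ.trans_le (min_le_right _ _))
  rw [hΦH, hΦH] at h2
  calc edist (H.refGraphon F' t).tilde (H.refGraphon F t).tilde
      ≤ edist (H.refGraphon F' t).tilde (H.refGraphon F (θ t)).tilde +
        edist (H.refGraphon F (θ t)).tilde (H.refGraphon F t).tilde := edist_triangle _ _ _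
    _ < ε / 2 + ε / 2 :=
        ENNReal.add_lt_add ((Kern.edist_tilde_le _ _).trans_lt h2) (hδt θ h1)
    _ = ε := ENNReal.add_halves ε

/-! ### Exponential equivalence at a fixed time -/

section DynamicGraph

variable {T : ℝ} {H : ConnFun T} {Ω : ℕ+ → Type*} [∀ n, MeasurableSpace (Ω n)]
  {P : ∀ n, Measure (Ω n)} {X : ∀ n : ℕ+, Fin n → Icc (0 : ℝ) T → Ω n → unitInterval}
  {F : ∀ n : ℕ+, Ω n → TypePath T} {G : ∀ n : ℕ+, Icc (0 : ℝ) T → Ω n → SimpleGraph (Fin n)}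

lemma IsDynamicGraph.hasCondIndepEdges (hG : IsDynamicGraph H P X F G) (n : ℕ+)
    (t : Icc (0 : ℝ) T) :
    HasCondIndepEdges ((⨆ i, MeasurableSpace.comap (X n i t) inferInstance) ⊔
      ⨆ s, MeasurableSpace.comap (fun ω => ((F n ω).toFun s).toMeasure) inferInstance) (P n)
      (G n t) fun ω i j => (H.toFun t (X n i t ω) (X n j t ω) (F n ω) : ℝ) where
  measurable_edge := hG.measurable_edge n t
  mem_Icc _ _ _ := (H.toFun _ _ _ _).2
  symm _ _ _ := by rw [H.symm]
  law g := hG.edge_law n t g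

/-- The speed `n ^ 2` of the concentration of the edges beats both the number `4 ^ n` of sign
patterns and the large deviation rate. -/
lemma eventually_exp_le {ℓ : ℕ+ → ℝ}
    (hℓ : ℓ =o[atTop] fun n : ℕ+ => (((n : ℕ).choose 2 : ℕ) : ℝ)) {c : ℝ} (hc : 0 < c) (b a : ℝ) :
    ∀ᶠ n : ℕ+ in atTop, Real.exp ((n : ℕ) * b - c * (n : ℕ) ^ 2) ≤ Real.exp (-a * ℓ n) := by
  have hd : 0 < c / (2 * (|a| + 1)) := by positivity
  have htend : Tendsto (fun n : ℕ+ => ((n : ℕ) : ℝ)) atTop atTop :=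
    tendsto_natCast_atTop_atTop.comp tendsto_PNat_val_atTop_atTop
  filter_upwards [hℓ.def hd, htend.eventually_ge_atTop (2 * b / c)] with n h1 h2
  rw [Real.exp_le_exp]
  have hch : (((n : ℕ).choose 2 : ℕ) : ℝ) ≤ (n : ℕ) ^ 2 := by
    exact_mod_cast Nat.choose_le_pow (n : ℕ) 2
  rw [Real.norm_eq_abs, Real.norm_eq_abs, Nat.abs_cast] at h1
  have h3 : a * ℓ n ≤ c / 2 * (n : ℕ) ^ 2 := by
    calc a * ℓ n ≤ |a| * |ℓ n| := by rw [← abs_mul]; exact le_abs_self _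
      _ ≤ (|a| + 1) * (c / (2 * (|a| + 1)) * (n : ℕ) ^ 2) := by
        refine mul_le_mul (by linarith) (h1.trans ?_) (abs_nonneg _) (by positivity)
        exact mul_le_mul_of_nonneg_left hch hd.le
      _ = c / 2 * (n : ℕ) ^ 2 := by field_simp
  rw [div_le_iff₀ hc] at h2
  have hn : (0 : ℝ) ≤ (n : ℕ) := Nat.cast_nonneg _
  nlinarith

/-- At each time the empirical graphon is exponentially close to the reference graphon, at every
large deviation rate below `n ^ 2`. -/
lemma IsDynamicGraph.exp_close [∀ n, IsProbabilityMeasure (P n)] (hG : IsDynamicGraph H P X F G)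
    {ℓ : ℕ+ → ℝ} (hℓ : ℓ =o[atTop] fun n : ℕ+ => (((n : ℕ).choose 2 : ℕ) : ℝ))
    (t : Icc (0 : ℝ) T) {ε : ℝ} (hε : 0 < ε) (a : ℝ) :
    ∀ᶠ n in atTop, P n {ω | ε ≤ Kern.cutMetric (empGraphon (G n t ω)) (H.refGraphon (F n ω) t)} ≤
      ENNReal.ofReal (Real.exp (-a * ℓ n)) := by
  -- the concentration bound is stated for parameters at most `1`
  set η : ℝ := min (ε / 2) 1
  have hη0 : 0 < η := lt_min (half_pos hε) one_pos
  have hηε : η < ε := (min_le_left _ _).trans_lt (half_lt_self hε)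
  have htend : Tendsto (fun n : ℕ+ => ((n : ℕ) : ℝ)) atTop atTop :=
    tendsto_natCast_atTop_atTop.comp tendsto_PNat_val_atTop_atTop
  filter_upwards [eventually_exp_le hℓ (c := η ^ 2 / 64) (by positivity) (Real.log 4) a,
    htend.eventually_ge_atTop (2 / η)] with n h1 h2
  refine le_trans (measure_mono fun ω hω => ?_)
    (((hG.hasCondIndepEdges n t).measure_exists_sgn_ge_le hη0 (min_le_right _ _) h2).trans
      (ENNReal.ofReal_le_ofReal h1))
  by_contra hcon
  simp only [mem_ofPred_eq, not_exists, not_le] at hcon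
  have hn : ((n : ℕ) : ℝ) ≠ 0 := by exact_mod_cast n.ne_zero
  have h3 := cutMetric_empGraphon_le H (F n ω) t (fun i => X n i t ω) (hG.path_eq n ω t) (G n t ω)
    fun s r => (hcon s r).le
  have h4 : (1 / ((n : ℕ) : ℝ)) ^ 2 * (η * (n : ℕ) ^ 2) = η := by field_simp
  rw [h4] at h3
  exact absurd (le_trans hω h3) (not_le.2 hηε)

/-- An entourage of the product uniformity constrains finitely many times. -/
lemma IsDynamicGraph.exp_close_pi [∀ n, IsProbabilityMeasure (P n)]
    (hG : IsDynamicGraph H P X F G) {ℓ : ℕ+ → ℝ} (hℓ0 : Tendsto ℓ atTop atTop)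
    (hℓ : ℓ =o[atTop] fun n : ℕ+ => (((n : ℕ).choose 2 : ℕ) : ℝ)) (S : Set (Icc (0 : ℝ) T))
    {V : Set ((S → UGraphon) × (S → UGraphon))} (hV : V ∈ uniformity (S → UGraphon)) (a : ℝ) :
    ∀ᶠ n in atTop, P n {ω | ((fun t : S => (H.refGraphon (F n ω) t).tilde),
      (fun t : S => (empGraphon (G n t ω)).tilde)) ∉ V} ≤
      ENNReal.ofReal (Real.exp (-a * ℓ n)) := by
  -- the relations that fail with super-exponentially small probability form a filter
  let L : Filter ((S → UGraphon) × (S → UGraphon)) :=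
    { sets := {W | ∀ a : ℝ, ∀ᶠ n in atTop, P n {ω | ((fun t : S => (H.refGraphon (F n ω) t).tilde),
        (fun t : S => (empGraphon (G n t ω)).tilde)) ∉ W} ≤ ENNReal.ofReal (Real.exp (-a * ℓ n))}
      univ_sets := fun a => by simp
      sets_of_superset := fun {W W'} hW hWW' a => by
        filter_upwards [hW a] with n hn
        refine le_trans (measure_mono fun ω hω => ?_) hn
        exact fun hmem => hω (hWW' hmem)
      inter_sets := fun {W W'} hW hW' a => by
        filter_upwards [hW (a + 1), hW' (a + 1), eventually_two_mul_exp_le hℓ0 (lt_add_one a)]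
          with n h1 h2 h3
        refine le_trans (measure_mono fun ω hω => ?_)
          ((measure_union_le _ _).trans ((add_le_add h1 h2).trans h3))
        by_contra hcon
        simp only [mem_union, mem_ofPred_eq, not_or, not_not] at hcon
        exact hω hcon }
  have hL : L ≤ uniformity (S → UGraphon) := by
    rw [Pi.uniformity]
    refine le_iInf fun t => map_le_iff_le_comap.1 fun W hW b => ?_
    obtain ⟨ε, hε, hεW⟩ := Metric.mem_uniformity_dist.1 hW
    filter_upwards [hG.exp_close hℓ t hε b] with n hn
    refine (measure_mono fun ω hω => ?_).trans hn
    by_contra hcon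
    refine hω (hεW ?_)
    rw [dist_comm]
    exact not_le.1 hcon
  exact hL hV a

end DynamicGraph

theorem mainTheorem5 {T : ℝ} (hT : 0 < T) (H : ConnFun T)
    {Ω : ℕ+ → Type*} [∀ n, MeasurableSpace (Ω n)]
    (P : ∀ n, Measure (Ω n)) [∀ n, IsProbabilityMeasure (P n)]
    (X : ∀ n : ℕ+, Fin n → Icc (0 : ℝ) T → Ω n → unitInterval)
    (F : ∀ n : ℕ+, Ω n → TypePath T)
    (G : ∀ n : ℕ+, Icc (0 : ℝ) T → Ω n → SimpleGraph (Fin n))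
    (hG : IsDynamicGraph H P X F G)
    (ℓ : ℕ+ → ℝ) (hℓ : ℓ =o[atTop] fun n : ℕ+ => (((n : ℕ).choose 2 : ℕ) : ℝ))
    (K : TypePath T → ENNReal)
    (hCP : H.InducesContinuousMap)
    (hDP : SatisfiesLDP P F ℓ K)
    (S : Set (Icc (0 : ℝ) T))
    (hS : ∀ t ∈ S, (t : ℝ) < T → ∀ F' : TypePath T, K F' ≠ ⊤ →
      ContinuousAt (fun s => (H.refGraphon F' s).tilde) t) :
    SatisfiesLDP P (fun n ω (t : S) => (empGraphon (G n t ω)).tilde) ℓ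
      (contractedRate H K S) := by
  have h := hDP.of_exponentially_equivalent (U := S → UGraphon)
    (Z := fun n ω (t : S) => (empGraphon (G n t ω)).tilde)
    (Ψ := fun F' (t : S) => (H.refGraphon F' t).tilde)
    (fun F' hF' => tendsto_pi_nhds.2 fun t =>
      hCP.continuousAt_tilde fun ht => hS t t.2 ht F' hF')
    fun V hV a => hG.exp_close_pi hDP.rate_tendsto hℓ S hV a
  have hJ : contractedRate H K S = fun u => ⨅ (F' : TypePath T)
      (_ : (fun t : S => (H.refGraphon F' t).tilde) = u), K F' := by
    funext u
    simp only [contractedRate, funext_iff]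
  rwa [hJ]
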